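/- Let $\mathbb D$ be the open unit disk of $\mathbb C$. For $\gamma>0$ let $\mathscr B_\gamma$ be the space of analytic functions $f$ on $\mathbb D$ with $\sup_{z\in\mathbb D}(1-|z|^2)^{\gamma}|f'(z)|<\infty$, normed by $\|f\|=|f(0)|+\sup_{z\in\mathbb D}(1-|z|^2)^{\gamma}|f'(z)|$, and let $\mathscr B=\mathscr B_1$ be the Bloch space. For a positive Borel measure $\mu$ on $[0,1)$ and $\alpha>0$ put $$\mathcal I_{\mu,\alpha}(f)(z)=\int_{[0,1)}\frac{f(t)}{(1-tz)^{\alpha}}\,d\mu(t),\qquad z\in\mathbb D,$$ whenever the integral converges absolutely for every $z\in\mathbb D$ and defines an analytic function on $\mathbb D$ (principal branch of the power). Identify $\mu$ with the Borel measure $A\mapsto\mu(A\cap[0,1))$ on $\mathbb D$. For an arc $I\subset\partial\mathbb D$ of length $|I|\in(0,2\pi]$ let $S(I)=\{re^{it}\in\mathbb D: e^{it}\in I,\ 1-\frac{|I|}{2\pi}\le r\le 1\}$. The measure $\mu$ is called a $1$-logarithmic $2$-Carleson measure if there is a constant $C>0$ such that $$\frac{\mu(S(I))\,\log\frac{2\pi}{|I|}}{|I|^{2}}\le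 C\quad\text{for all arcs } I\subset\partial\mathbb D,$$ and a vanishing $1$-logarithmic $2$-Carleson measure if $\mu(S(I))\log\frac{2\pi}{|I|}=o(|I|^2)$ as $|I|\to0$, uniformly in the position of $I$. **Theorem.** Let $\alpha\ge 2$ and let $\mu$ be a positive Borel measure on $[0,1)$ with $\int_{[0,1)}\log\frac{e}{1-t}\,d\mu(t)<\infty$. Then (i) $\mathcal I_{\mu,\alpha}$ is a bounded operator from $\mathscr B$ into $\mathscr B_{\alpha-1}$ if and only if $\mu$ is a $1$-logarithmic $2$-Carleson measure; (ii) $\mathcal I_{\mu,\alpha}$ is a compact operator from $\mathscr B$ into $\mathscr B_{\alpha-1}$ if and only if $\mu$ is a vanishing $1$-logarithmic $2$-Carleson measure. -/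

import Mathlib

open MeasureTheory

namespace GenHilbert

noncomputable section

/-- The open unit disk of the complex plane, as a type. -/
abbrev Disk : Type := Metric.ball (0 : ℂ) 1

/-- The interval `[0,1)`, as a type. -/
abbrev UnitIco : Type := Set.Ico (0 : ℝ) 1

/-- The centre of the disk. -/
def Disk.zero : Disk := ⟨0, by simp⟩

/-- Extension by zero of a function on the disk to the whole plane. The disk is open, so the
complex derivative of the extension at a point of the disk only sees the original function. -/
def extend (f : Disk → ℂ) : ℂ → ℂ := Function.extend Subtype.val f 0

theorem extend_apply (f : Disk → ℂ) (z : Disk) : extend f (z : ℂ) = f z :=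
  Subtype.val_injective.extend_apply f 0 z

theorem extend_add (f g : Disk → ℂ) : extend (f + g) = extend f + extend g := by
  have h := Function.extend_add (Subtype.val : Disk → ℂ) f g (0 : ℂ → ℂ) 0
  simpa [extend] using h

theorem extend_smul (c : ℂ) (f : Disk → ℂ) : extend (c • f) = c • extend f := by
  have h := Function.extend_smul c (Subtype.val : Disk → ℂ) f (0 : ℂ → ℂ)
  simpa [extend] using h

theorem extend_zero : extend 0 = 0 := by
  have h := extend_smul 0 (0 : Disk → ℂ)
  simpa using h

/-- `f ∈ H(𝔻)`: `f` is analytic (i.e. complex differentiable) on the open unit disk. -/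
def IsAnalytic (f : Disk → ℂ) : Prop := DifferentiableOn ℂ (extend f) (Metric.ball 0 1)

/-- The derivative `f'(z)` of a function on the disk. -/
def diskDeriv (f : Disk → ℂ) (z : Disk) : ℂ := deriv (extend f) z

theorem IsAnalytic.differentiableAt {f : Disk → ℂ} (hf : IsAnalytic f) (z : Disk) :
    DifferentiableAt ℂ (extend f) z :=
  DifferentiableOn.differentiableAt hf (Metric.isOpen_ball.mem_nhds z.2)

theorem diskDeriv_add {f g : Disk → ℂ} (hf : IsAnalytic f) (hg : IsAnalytic g) (z : Disk) :
    diskDeriv (f + g) z = diskDeriv f z + diskDeriv g z := by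
  simp only [diskDeriv, extend_add]
  exact deriv_add (hf.differentiableAt z) (hg.differentiableAt z)

theorem diskDeriv_smul {f : Disk → ℂ} (hf : IsAnalytic f) (c : ℂ) (z : Disk) :
    diskDeriv (c • f) z = c * diskDeriv f z := by
  simp only [diskDeriv, extend_smul]
  exact (((hf.differentiableAt z).hasDerivAt).const_smul c).deriv

/-- The weighted derivative `(1 - |z|²)^α |f'(z)|`. -/
def blochWeight (α : ℝ) (f : Disk → ℂ) (z : Disk) : ℝ :=
  (1 - ‖(z : ℂ)‖ ^ 2) ^ α * ‖diskDeriv f z‖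

theorem Disk.one_sub_sq_pos (z : Disk) : 0 < 1 - ‖(z : ℂ)‖ ^ 2 := by
  have h : ‖(z : ℂ)‖ < 1 := mem_ball_zero_iff.mp z.2
  nlinarith [norm_nonneg (z : ℂ)]

theorem blochWeight_nonneg (α : ℝ) (f : Disk → ℂ) (z : Disk) : 0 ≤ blochWeight α f z :=
  mul_nonneg (Real.rpow_nonneg z.one_sub_sq_pos.le _) (norm_nonneg _)

theorem blochWeight_add_le (α : ℝ) {f g : Disk → ℂ} (hf : IsAnalytic f) (hg : IsAnalytic g)
    (z : Disk) : blochWeight α (f + g) z ≤ blochWeight α f z + blochWeight α g z := by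
  simp only [blochWeight, diskDeriv_add hf hg, ← mul_add]
  exact mul_le_mul_of_nonneg_left (norm_add_le _ _) (Real.rpow_nonneg z.one_sub_sq_pos.le _)

theorem blochWeight_smul (α : ℝ) {f : Disk → ℂ} (hf : IsAnalytic f) (c : ℂ) (z : Disk) :
    blochWeight α (c • f) z = ‖c‖ * blochWeight α f z := by
  simp only [blochWeight, diskDeriv_smul hf, norm_mul]
  ring

/-- The `α`-Bloch space as a linear subspace of the functions on the disk: the analytic `f` with
`sup_z (1 - |z|²)^α |f'(z)| < ∞`. -/
def blochSubmodule (α : ℝ) : Submodule ℂ (Disk → ℂ) where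
  carrier := {f | IsAnalytic f ∧ BddAbove (Set.range (blochWeight α f))}
  zero_mem' := by
    refine ⟨?_, 0, ?_⟩
    · simp only [IsAnalytic, extend_zero]
      exact differentiableOn_const 0
    · rintro _ ⟨z, rfl⟩
      simp [blochWeight, diskDeriv, extend_zero]
  add_mem' := by
    rintro f g ⟨hf, A, hA⟩ ⟨hg, B, hB⟩
    refine ⟨?_, A + B, ?_⟩
    · simp only [IsAnalytic, extend_add]
      exact DifferentiableOn.add hf hg
    · rintro _ ⟨z, rfl⟩
      exact (blochWeight_add_le α hf hg z).trans (add_le_add (hA ⟨z, rfl⟩) (hB ⟨z, rfl⟩))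
  smul_mem' := by
    rintro c f ⟨hf, A, hA⟩
    refine ⟨?_, ‖c‖ * A, ?_⟩
    · simp only [IsAnalytic, extend_smul]
      exact DifferentiableOn.const_smul hf c
    · rintro _ ⟨z, rfl⟩
      rw [blochWeight_smul α hf]
      exact mul_le_mul_of_nonneg_left (hA ⟨z, rfl⟩) (norm_nonneg c)

/-- The `α`-Bloch space. It is a separate type, so that it carries the topology of the Bloch norm
below and not the topology of pointwise convergence. -/
def Bloch (α : ℝ) : Type := blochSubmodule α

namespace Bloch

variable {α : ℝ}

instance : AddCommGroup (Bloch α) := inferInstanceAs (AddCommGroup (blochSubmodule α))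

instance : Module ℂ (Bloch α) := inferInstanceAs (Module ℂ (blochSubmodule α))

/-- The underlying function on the disk. -/
def toFun (f : Bloch α) : Disk → ℂ := Subtype.val (p := fun g => g ∈ blochSubmodule α) f

instance : CoeFun (Bloch α) (fun _ => Disk → ℂ) := ⟨toFun⟩

theorem toFun_injective : Function.Injective (toFun : Bloch α → Disk → ℂ) :=
  Subtype.val_injective

theorem toFun_zero : (0 : Bloch α).toFun = 0 := rfl

theorem toFun_add (f g : Bloch α) : (f + g).toFun = f.toFun + g.toFun := rfl

theorem toFun_smul (c : ℂ) (f : Bloch α) : (c • f).toFun = c • f.toFun := rfl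

theorem isAnalytic (f : Bloch α) : IsAnalytic f :=
  (Subtype.property (p := fun g => g ∈ blochSubmodule α) f).1

theorem bddAbove (f : Bloch α) : BddAbove (Set.range (blochWeight α f)) :=
  (Subtype.property (p := fun g => g ∈ blochSubmodule α) f).2

/-- The seminorm `sup_z (1 - |z|²)^α |f'(z)|`. -/
def seminorm (f : Bloch α) : ℝ := ⨆ z : Disk, blochWeight α f z

theorem seminorm_nonneg (f : Bloch α) : 0 ≤ f.seminorm :=
  Real.iSup_nonneg fun z => blochWeight_nonneg α f z

/-- The Bloch norm `|f(0)| + sup_z (1 - |z|²)^α |f'(z)|`. -/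
instance : Norm (Bloch α) := ⟨fun f => ‖f Disk.zero‖ + f.seminorm⟩

theorem norm_def (f : Bloch α) : ‖f‖ = ‖f Disk.zero‖ + f.seminorm := rfl

theorem eq_zero_of_norm_eq_zero (f : Bloch α) (h : ‖f‖ = 0) : f = 0 := by
  rw [norm_def] at h
  have h0 : ‖f Disk.zero‖ = 0 := by linarith [f.seminorm_nonneg, norm_nonneg (f Disk.zero)]
  have hs : f.seminorm = 0 := by linarith [f.seminorm_nonneg, norm_nonneg (f Disk.zero)]
  have hd : ∀ z : Disk, diskDeriv f z = 0 := by
    intro z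
    have hz : blochWeight α f z ≤ 0 := hs ▸ le_ciSup f.bddAbove z
    have hp : 0 < (1 - ‖(z : ℂ)‖ ^ 2) ^ α := Real.rpow_pos_of_pos z.one_sub_sq_pos α
    have hn : ‖diskDeriv f z‖ ≤ 0 := by
      by_contra hc
      push Not at hc
      exact absurd hz (not_le.mpr (mul_pos hp hc))
    exact norm_le_zero_iff.mp hn
  apply toFun_injective
  funext z
  have hc := Metric.isOpen_ball.is_const_of_deriv_eq_zero
    (convex_ball (0 : ℂ) 1).isPreconnected f.isAnalytic
    (fun w hw => hd ⟨w, hw⟩) z.2 Disk.zero.2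
  rw [extend_apply, extend_apply] at hc
  rw [hc, norm_eq_zero.mp h0, toFun_zero]
  rfl

theorem core : NormedSpace.Core ℂ (Bloch α) where
  norm_nonneg f := add_nonneg (norm_nonneg _) f.seminorm_nonneg
  norm_smul c f := by
    have hs : (c • f).seminorm = ‖c‖ * f.seminorm := by
      simp only [seminorm, toFun_smul, blochWeight_smul α f.isAnalytic]
      exact (Real.mul_iSup_of_nonneg (norm_nonneg c) _).symm
    rw [norm_def, norm_def, hs, toFun_smul, Pi.smul_apply, norm_smul, mul_add]
  norm_triangle f g := by
    have hs : (f + g).seminorm ≤ f.seminorm + g.seminorm := by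
      have : Nonempty Disk := ⟨Disk.zero⟩
      refine ciSup_le fun z => ?_
      exact (blochWeight_add_le α f.isAnalytic g.isAnalytic z).trans
        (add_le_add (le_ciSup f.bddAbove z) (le_ciSup g.bddAbove z))
    have h0 : ‖(f + g).toFun Disk.zero‖ ≤ ‖f Disk.zero‖ + ‖g Disk.zero‖ := by
      rw [toFun_add]
      exact norm_add_le _ _
    rw [norm_def, norm_def, norm_def]
    linarith
  norm_eq_zero_iff f := by
    refine ⟨eq_zero_of_norm_eq_zero f, ?_⟩
    rintro rfl
    have hw : ∀ z : Disk, blochWeight α (0 : Disk → ℂ) z = 0 := fun z => by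
      simp [blochWeight, diskDeriv, extend_zero]
    simp [norm_def, seminorm, toFun_zero, hw]

instance : NormedAddCommGroup (Bloch α) := NormedAddCommGroup.ofCore core

instance : NormedSpace ℂ (Bloch α) := NormedSpace.ofCore core

end Bloch

/-- The inclusion `[0,1) ⊂ 𝔻`. -/
def toDisk (t : UnitIco) : Disk :=
  ⟨((t : ℝ) : ℂ), by
    rw [mem_ball_zero_iff, Complex.norm_real, Real.norm_eq_abs, abs_of_nonneg t.2.1]
    exact t.2.2⟩

theorem measurable_toDisk : Measurable toDisk :=
  (Complex.measurable_ofReal.comp measurable_subtype_coe).subtype_mk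

/-- A Borel measure on `[0,1)` seen as a Borel measure on the disk: `A ↦ μ (A ∩ [0,1))`. -/
def diskMeasure (μ : Measure UnitIco) : Measure Disk := μ.map toDisk

/-- The Carleson box `S(I)` over the arc `I = {e^{it} : θ ≤ t ≤ θ + ℓ}` of length `ℓ`. -/
def carlesonBox (θ ℓ : ℝ) : Set ℂ :=
  {z | ∃ r t : ℝ, t ∈ Set.Icc θ (θ + ℓ) ∧ 1 - ℓ / (2 * Real.pi) ≤ r ∧ r ≤ 1 ∧
    z = r * Complex.exp (t * Complex.I)}

/-- The quantity `μ(S(I)) (log (2π/|I|))^a` for the arc `I = {e^{it} : θ ≤ t ≤ θ + ℓ}`. -/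
def logBoxMass (a : ℝ) (μ : Measure Disk) (θ ℓ : ℝ) : ENNReal :=
  μ (Subtype.val ⁻¹' carlesonBox θ ℓ) * ENNReal.ofReal (Real.log (2 * Real.pi / ℓ) ^ a)

/-- `μ` is an `a`-logarithmic `s`-Carleson measure on the disk. It is enough to test closed arcs:
every other nondegenerate arc lies in a closed one of the same length. -/
def IsLogCarleson (a s : ℝ) (μ : Measure Disk) : Prop :=
  ∃ C : ℝ, 0 < C ∧ ∀ θ ℓ : ℝ, 0 < ℓ → ℓ ≤ 2 * Real.pi →
    logBoxMass a μ θ ℓ / ENNReal.ofReal (ℓ ^ s) ≤ ENNReal.ofReal C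

/-- `μ` is a vanishing `a`-logarithmic `s`-Carleson measure on the disk:
`μ(S(I)) (log (2π/|I|))^a = o(|I|^s)` as `|I| → 0`, uniformly in the position of `I`. -/
def IsVanishingLogCarleson (a s : ℝ) (μ : Measure Disk) : Prop :=
  ∀ ε : ℝ, 0 < ε → ∃ δ : ℝ, 0 < δ ∧ ∀ θ ℓ : ℝ, 0 < ℓ → ℓ ≤ 2 * Real.pi → ℓ < δ →
    logBoxMass a μ θ ℓ / ENNReal.ofReal (ℓ ^ s) ≤ ENNReal.ofReal ε

/-- The integrand `f(t) / (1 - t z)^α`, with the principal branch of the power; `1 - t z` has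
positive real part. -/
def hilbertIntegrand (α : ℝ) (f : Disk → ℂ) (z : Disk) (t : UnitIco) : ℂ :=
  f (toDisk t) / (1 - ((t : ℝ) : ℂ) * (z : ℂ)) ^ (α : ℂ)

/-- `g = I_{μ,α}(f)`: for every `z` in the disk the integral `∫ f(t) / (1 - t z)^α dμ(t)` over
`[0,1)` converges absolutely and equals `g(z)`, and `g` is analytic. -/
def IsIntegralHilbert (μ : Measure UnitIco) (α : ℝ) (f g : Disk → ℂ) : Prop :=
  IsAnalytic g ∧ ∀ z : Disk, Integrable (hilbertIntegrand α f z) μ ∧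
    g z = ∫ t, hilbertIntegrand α f z t ∂μ

/-- `I_{μ,α}` is (well defined and) a bounded operator from `B_β` into `B_γ`. -/
def IntegralHilbertBounded (μ : Measure UnitIco) (α β γ : ℝ) : Prop :=
  ∃ T : Bloch β →L[ℂ] Bloch γ, ∀ f : Bloch β, IsIntegralHilbert μ α f (T f)

/-- `I_{μ,α}` is (well defined and) a compact operator from `B_β` into `B_γ`. -/
def IntegralHilbertCompact (μ : Measure UnitIco) (α β γ : ℝ) : Prop :=
  ∃ T : Bloch β →L[ℂ] Bloch γ, (∀ f : Bloch β, IsIntegralHilbert μ α f (T f)) ∧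
    IsCompactOperator T

end

end GenHilbert

open MeasureTheory

namespace GenHilbert

noncomputable section

open Filter Topology

/-! ### Growth estimates and completeness of the Bloch spaces -/

namespace Bloch

variable {γ : ℝ}

/-! Only the tails of `μ` at `1` matter. A box over an arc of length `2πu` meets `[0,1)` inside `[1
- u, 1)`, and in all of it when the arc is centred at `1`. So the Carleson condition says `μ[1 - u,
1) log(1/u) ≤ C u²`, which for finite `μ` amounts to a `TailBound` at scale `1`; the vanishing
condition gives `TailBound μ ε s` for every `ε`, with `s` depending on `ε`.

Sufficiency. A Bloch function satisfies `|f(t)| ≤ ‖f‖ log(e/(1 - t))`. Differentiating under the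
integral gives the kernel `α t (1 - tz)^(-α-1)`. Since `α ≥ 2`, the weight `(1 - |z|²)^(α-1)`
absorbs `α - 2` of its powers and leaves a multiple of `(1 - r)(1 - tr)⁻³`, `r = |z|`
(`weight_mul_kernel_le`). It remains to bound `∫ log(e/(1 - t)) (1 - tr)⁻³ dμ` by a multiple of
`1/(1 - r)`, and two layer-cake computations do this (`lintegral_endSet_logWeight_mul_le`). For
compactness, sampling `f` on a grid gives finite-rank operators. They converge in operator norm:
near `1` the error is small by the vanishing tails, away from `1` by the fine mesh
(`cubicBound_sub_sampled`).

Necessity. Test with `log((1 - ρz)/(1 - z))`, bounded in the Bloch space uniformly in `ρ`.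
Positivity makes the derivative of its image at `1 - s` at least a multiple of `s^(-α-1) μ[1 - s, 1)
log((1 - ρ)/s)` (`measure_endSet_mul_le`). Boundedness needs only `ρ = 0`. As `ρ → 1` the test
functions tend to zero on `[0,1)`, so a compact operator makes some image small in norm
(`exists_norm_integralHilbert_le`), and that one `ρ` controls all sufficiently small `s`. -/

theorem blochWeight_le_norm (f : Bloch γ) (z : Disk) : blochWeight γ f z ≤ ‖f‖ := by
  have h1 : blochWeight γ f z ≤ f.seminorm := le_ciSup f.bddAbove z
  rw [norm_def]
  linarith [norm_nonneg (f Disk.zero)]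

theorem norm_le_of_blochWeight_le (f : Bloch γ) {C : ℝ} (h : ∀ z, blochWeight γ f z ≤ C) :
    ‖f‖ ≤ ‖f Disk.zero‖ + C := by
  have : Nonempty Disk := ⟨Disk.zero⟩
  rw [norm_def]
  gcongr
  exact ciSup_le h

theorem norm_deriv_le (hγ : 0 ≤ γ) (f : Bloch γ) {r : ℝ} (hr : r < 1) {z : ℂ} (hz : ‖z‖ ≤ r) :
    ‖deriv (extend f) z‖ ≤ ‖f‖ * ((1 - r ^ 2) ^ γ)⁻¹ := by
  have hr0 : 0 ≤ r := (norm_nonneg z).trans hz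
  have hp : 0 < 1 - r ^ 2 := by nlinarith
  have h := blochWeight_le_norm f ⟨z, mem_ball_zero_iff.mpr (hz.trans_lt hr)⟩
  rw [← div_eq_mul_inv, le_div_iff₀ (Real.rpow_pos_of_pos hp γ), mul_comm]
  refine le_trans ?_ h
  simp only [blochWeight, diskDeriv]
  gcongr

theorem norm_sub_le (hγ : 0 ≤ γ) (f : Bloch γ) {r : ℝ} (hr : r < 1) {z w : ℂ} (hz : ‖z‖ ≤ r)
    (hw : ‖w‖ ≤ r) :
    ‖extend f z - extend f w‖ ≤ ‖f‖ * ((1 - r ^ 2) ^ γ)⁻¹ * ‖z - w‖ := by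
  refine (convex_closedBall (0 : ℂ) r).norm_image_sub_le_of_norm_deriv_le (𝕜 := ℂ) (fun x hx => ?_)
    (fun x hx => norm_deriv_le hγ f hr (mem_closedBall_zero_iff.mp hx))
    (mem_closedBall_zero_iff.mpr hw) (mem_closedBall_zero_iff.mpr hz)
  exact f.isAnalytic.differentiableAt
    ⟨x, mem_ball_zero_iff.mpr ((mem_closedBall_zero_iff.mp hx).trans_lt hr)⟩

theorem norm_extend_le (hγ : 0 ≤ γ) (f : Bloch γ) {r : ℝ} (hr : r < 1) {z : ℂ} (hz : ‖z‖ ≤ r) :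
    ‖extend f z‖ ≤ (1 + ((1 - r ^ 2) ^ γ)⁻¹) * ‖f‖ := by
  have hr0 : 0 ≤ r := (norm_nonneg z).trans hz
  have hp : 0 < 1 - r ^ 2 := by nlinarith
  have h := norm_sub_le hγ f hr hz (w := 0) (by simpa using hr0)
  have h0 : ‖extend f 0‖ ≤ ‖f‖ := by
    have : extend f 0 = f Disk.zero := extend_apply f Disk.zero
    rw [this, norm_def]
    linarith [f.seminorm_nonneg]
  have h2 : ‖extend f z‖ ≤ ‖extend f z - extend f 0‖ + ‖extend f 0‖ := by
    simpa using norm_add_le (extend f z - extend f 0) (extend f 0)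
  rw [sub_zero] at h
  have h3 : ‖f‖ * ((1 - r ^ 2) ^ γ)⁻¹ * ‖z‖ ≤ ‖f‖ * ((1 - r ^ 2) ^ γ)⁻¹ * 1 := by
    gcongr
    linarith
  linarith

theorem extend_sub (f g : Bloch γ) (z : ℂ) :
    extend (f - g : Bloch γ).toFun z = extend f z - extend g z := by
  have h : (f - g : Bloch γ).toFun = f.toFun + (-1 : ℂ) • g.toFun := by
    rw [← toFun_smul, ← toFun_add, neg_one_smul, sub_eq_add_neg]
  rw [h, extend_add, extend_smul]
  simp [sub_eq_add_neg]

/-- Point evaluation on the Bloch space. -/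
def eval (hγ : 0 ≤ γ) (z : Disk) : Bloch γ →L[ℂ] ℂ :=
  LinearMap.mkContinuous
    { toFun := fun f => f z
      map_add' := fun _ _ => rfl
      map_smul' := fun _ _ => rfl }
    (1 + ((1 - ‖(z : ℂ)‖ ^ 2) ^ γ)⁻¹) (fun f => by
      have h := norm_extend_le hγ f (mem_ball_zero_iff.mp z.2) le_rfl
      rwa [extend_apply] at h)

/-- Needed because norm limits of compact operators are compact when the target is complete. Norm
control gives uniform control on compact sets, so the pointwise limit is analytic and derivatives
converge; the weighted bounds then pass to the limit. -/
theorem completeSpace (hγ : 0 ≤ γ) : CompleteSpace (Bloch γ) := by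
  refine Metric.complete_of_cauchySeq_tendsto fun u hu => ?_
  have hlim : ∀ z : Disk, ∃ a, Tendsto (fun n => (u n) z) atTop (𝓝 a) := fun z =>
    cauchySeq_tendsto_of_complete ((eval hγ z).uniformContinuous.comp_cauchySeq hu)
  choose g hg using hlim
  have hpt : ∀ z ∈ Metric.ball (0 : ℂ) 1,
      Tendsto (fun n => extend (u n) z) atTop (𝓝 (extend g z)) := by
    intro z hz
    have h := hg ⟨z, hz⟩
    rw [← extend_apply g] at h
    refine h.congr fun n => ?_
    exact (extend_apply (u n) ⟨z, hz⟩).symm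
  have hloc : TendstoLocallyUniformlyOn (fun n => extend (u n)) (extend g) atTop
      (Metric.ball 0 1) := by
    rw [tendstoLocallyUniformlyOn_iff_forall_isCompact Metric.isOpen_ball]
    intro K hK hKc
    have hr : ∃ r < 1, ∀ z ∈ K, ‖z‖ ≤ r := by
      rcases K.eq_empty_or_nonempty with rfl | hne
      · exact ⟨0, one_pos, by simp⟩
      · obtain ⟨x, hx, hmax⟩ := hKc.exists_isMaxOn hne continuous_norm.continuousOn
        exact ⟨‖x‖, mem_ball_zero_iff.mp (hK hx), fun z hz => hmax hz⟩
    obtain ⟨r, hr, hKr⟩ := hr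
    refine UniformCauchySeqOn.tendstoUniformlyOn_of_tendsto ?_ fun z hz => hpt z (hK hz)
    rw [Metric.uniformCauchySeqOn_iff]
    intro ε hε
    set M := 1 + ((1 - r ^ 2) ^ γ)⁻¹
    rcases K.eq_empty_or_nonempty with rfl | ⟨x0, hx0⟩
    · exact ⟨0, by simp⟩
    have hr0 : 0 ≤ r := (norm_nonneg x0).trans (hKr x0 hx0)
    have hM : 0 < M := by
      have : 0 < 1 - r ^ 2 := by nlinarith
      positivity
    obtain ⟨N, hN⟩ := Metric.cauchySeq_iff.mp hu (ε / M) (by positivity)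
    refine ⟨N, fun m hm n hn z hz => ?_⟩
    rw [dist_eq_norm, ← extend_sub]
    refine (norm_extend_le hγ _ hr (hKr z hz)).trans_lt ?_
    have h := hN m hm n hn
    rw [dist_eq_norm, lt_div_iff₀ hM] at h
    linarith
  have hgan : IsAnalytic g :=
    hloc.differentiableOn (Eventually.of_forall fun n => (u n).isAnalytic) Metric.isOpen_ball
  have hder : ∀ z : Disk, Tendsto (fun n => diskDeriv (u n) z) atTop (𝓝 (diskDeriv g z)) :=
    fun z => (hloc.deriv (Eventually.of_forall fun n => (u n).isAnalytic)
      Metric.isOpen_ball).tendsto_at z.2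
  -- Let `m → ∞` in the Cauchy estimate for `u m - u n` with `z` fixed; the bound does not depend on
  -- `z`.
  have hweight : ∀ ε > 0, ∃ N, ∀ n ≥ N, ∀ z, blochWeight γ (g + (-1 : ℂ) • (u n).toFun) z ≤ ε := by
    intro ε hε
    obtain ⟨N, hN⟩ := Metric.cauchySeq_iff.mp hu ε hε
    refine ⟨N, fun n hn z => ?_⟩
    have hneg : IsAnalytic ((-1 : ℂ) • (u n).toFun) := by
      rw [← toFun_smul]
      exact isAnalytic _
    have ht : Tendsto (fun m => blochWeight γ ((u m).toFun + (-1 : ℂ) • (u n).toFun) z) atTop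
        (𝓝 (blochWeight γ (g + (-1 : ℂ) • (u n).toFun) z)) := by
      simp only [blochWeight]
      refine (Tendsto.norm ?_).const_mul _
      rw [diskDeriv_add hgan hneg]
      refine ((hder z).add_const _).congr fun m => ?_
      rw [diskDeriv_add (u m).isAnalytic hneg]
    refine le_of_tendsto ht (eventually_atTop.mpr ⟨N, fun m hm => ?_⟩)
    have h := (blochWeight_le_norm (u m - u n) z).trans ((dist_eq_norm (u m) (u n)).symm.le.trans (hN m hm n hn).le)
    have he : (u m - u n : Bloch γ).toFun = (u m).toFun + (-1 : ℂ) • (u n).toFun := by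
      rw [← toFun_smul, ← toFun_add, neg_one_smul, sub_eq_add_neg]
    rwa [he] at h
  -- Membership is inherited through `g = (g - u N) + u N`.
  have hmem : g ∈ blochSubmodule γ := by
    obtain ⟨N, hN⟩ := hweight 1 one_pos
    have hneg : (-1 : ℂ) • (u N).toFun ∈ blochSubmodule γ :=
      (blochSubmodule γ).smul_mem _ (u N).2
    have h1 : g + (-1 : ℂ) • (u N).toFun ∈ blochSubmodule γ := by
      refine ⟨?_, 1, ?_⟩
      · simp only [IsAnalytic, extend_add]
        exact DifferentiableOn.add hgan hneg.1
      · rintro _ ⟨z, rfl⟩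
        exact hN N le_rfl z
    exact ((blochSubmodule γ).add_mem_iff_left hneg).mp h1
  let G : Bloch γ := ⟨g, hmem⟩
  refine ⟨G, ?_⟩
  rw [Metric.tendsto_atTop]
  intro ε hε
  obtain ⟨N, hN⟩ := hweight (ε / 3) (by positivity)
  obtain ⟨N', hN'⟩ := Metric.tendsto_atTop.mp (hg Disk.zero) (ε / 3) (by positivity)
  refine ⟨max N N', fun n hn => ?_⟩
  have he : (G - u n : Bloch γ).toFun = g + (-1 : ℂ) • (u n).toFun := by
    have : G.toFun = g := rfl
    rw [← this, ← toFun_smul, ← toFun_add, neg_one_smul, sub_eq_add_neg]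
  rw [dist_comm, dist_eq_norm]
  have h1 := norm_le_of_blochWeight_le (G - u n) (C := ε / 3) (by
    rw [he]
    exact hN n ((le_max_left _ _).trans hn))
  have h2 := hN' n ((le_max_right _ _).trans hn)
  rw [dist_comm, dist_eq_norm] at h2
  have h3 : (G - u n : Bloch γ).toFun Disk.zero = g Disk.zero - (u n) Disk.zero := by
    rw [he]
    simp [sub_eq_add_neg]
  rw [h3] at h1
  linarith

end Bloch

/-! ### Logarithmic growth along the radius -/

/-- The weight `log (e / (1 - t))`, which controls the growth of Bloch functions. -/
def logWeight (t : UnitIco) : ℝ := Real.log (Real.exp 1 / (1 - (t : ℝ)))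

theorem one_sub_pos (t : UnitIco) : 0 < 1 - (t : ℝ) := sub_pos.mpr t.2.2

theorem logWeight_eq (t : UnitIco) : logWeight t = 1 - Real.log (1 - (t : ℝ)) := by
  rw [logWeight, Real.log_div (Real.exp_ne_zero 1) (one_sub_pos t).ne', Real.log_exp]

theorem one_le_logWeight (t : UnitIco) : 1 ≤ logWeight t := by
  rw [logWeight_eq]
  have := Real.log_nonpos (one_sub_pos t).le (by linarith [t.2.1])
  linarith

theorem logWeight_mono {s t : UnitIco} (h : s ≤ t) : logWeight s ≤ logWeight t := by
  rw [logWeight_eq, logWeight_eq]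
  have : Real.log (1 - (t : ℝ)) ≤ Real.log (1 - (s : ℝ)) :=
    Real.log_le_log (one_sub_pos t) (sub_le_sub_left (Subtype.coe_le_coe.mpr h) 1)
  linarith

theorem measurable_logWeight : Measurable logWeight := by
  unfold logWeight
  fun_prop

/-- Integrate `|f'(x)| ≤ ‖f‖/(1 - x²) ≤ ‖f‖/(1 - x)` from `0` to `t`; the summand `1` in `logWeight`
pays for `|f(0)| ≤ ‖f‖`. -/
theorem Bloch.norm_apply_toDisk_le (f : Bloch 1) (t : UnitIco) :
    ‖f (toDisk t)‖ ≤ ‖f‖ * logWeight t := by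
  have ht := one_sub_pos t
  have hd : ∀ x ∈ Set.Icc (0 : ℝ) t, HasDerivAt (fun y : ℝ => extend f (y : ℂ))
      (deriv (extend f) (x : ℂ)) x := by
    intro x hx
    have hxb : (x : ℂ) ∈ Metric.ball (0 : ℂ) 1 := by
      rw [mem_ball_zero_iff, Complex.norm_real, Real.norm_eq_abs, abs_of_nonneg hx.1]
      linarith [hx.2]
    exact (f.isAnalytic.differentiableAt ⟨x, hxb⟩).hasDerivAt.comp_ofReal
  have hB : ∀ x ∈ Set.Icc (0 : ℝ) t,
      HasDerivAt (fun y : ℝ => ‖f‖ * (1 - Real.log (1 - y))) (‖f‖ * (1 - x)⁻¹) x := by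
    intro x hx
    have hx1 : 1 - x ≠ 0 := by linarith [hx.2]
    have h := (((((hasDerivAt_id x).const_sub 1).log hx1).const_sub 1).const_mul ‖f‖)
    rwa [neg_div, neg_neg, one_div] at h
  have key := image_norm_le_of_norm_deriv_right_le_deriv_boundary'
    (f := fun y : ℝ => extend f (y : ℂ)) (a := 0) (b := t)
    (fun x hx => (hd x hx).continuousAt.continuousWithinAt)
    (fun x hx => (hd x (Set.Ico_subset_Icc_self hx)).hasDerivWithinAt)
    (B := fun y : ℝ => ‖f‖ * (1 - Real.log (1 - y))) ?_
    (fun x hx => (hB x hx).continuousAt.continuousWithinAt)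
    (fun x hx => (hB x (Set.Ico_subset_Icc_self hx)).hasDerivWithinAt) ?_
    (x := t) ⟨t.2.1, le_rfl⟩
  · rw [logWeight_eq]
    have h2 : extend f ((t : ℝ) : ℂ) = f (toDisk t) := extend_apply f (toDisk t)
    rwa [h2] at key
  · have : extend f ((0 : ℝ) : ℂ) = f Disk.zero := by
      rw [Complex.ofReal_zero]
      exact extend_apply f Disk.zero
    rw [this, norm_def]
    simpa using f.seminorm_nonneg
  · intro x hx
    have hx1 : x < 1 := hx.2.trans t.2.2
    have h := norm_deriv_le zero_le_one f hx1 (z := (x : ℂ))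
      (by rw [Complex.norm_real, Real.norm_eq_abs, abs_of_nonneg hx.1])
    refine h.trans ?_
    rw [Real.rpow_one]
    have : 0 < 1 - x := by linarith
    gcongr
    nlinarith [hx.1]

theorem Bloch.norm_apply_toDisk_sub_le (f : Bloch 1) {s t : UnitIco} (h : s ≤ t) :
    ‖f (toDisk t) - f (toDisk s)‖ ≤ ‖f‖ * (1 - (t : ℝ))⁻¹ * ((t : ℝ) - s) := by
  have ht := one_sub_pos t
  have hst : (s : ℝ) ≤ t := h
  have hn : ∀ u : UnitIco, ‖((u : ℝ) : ℂ)‖ = u := fun u => by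
    rw [Complex.norm_real, Real.norm_eq_abs, abs_of_nonneg u.2.1]
  have key := norm_sub_le zero_le_one f t.2.2 (hn t).le ((hn s).trans_le hst)
  have h1 : ∀ u : UnitIco, extend f ((u : ℝ) : ℂ) = f (toDisk u) := fun u =>
    extend_apply f (toDisk u)
  rw [h1, h1, ← Complex.ofReal_sub, Complex.norm_real, Real.norm_eq_abs,
    abs_of_nonneg (sub_nonneg.mpr hst), Real.rpow_one] at key
  refine key.trans ?_
  gcongr
  nlinarith [t.2.1]

theorem Bloch.continuous_apply_toDisk {γ : ℝ} (f : Bloch γ) :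
    Continuous fun t : UnitIco => f (toDisk t) := by
  have h : (fun t : UnitIco => f (toDisk t)) = fun t : UnitIco => extend f (toDisk t : ℂ) :=
    funext fun t => (extend_apply f (toDisk t)).symm
  rw [h]
  refine f.isAnalytic.continuousOn.comp_continuous ?_ fun t => (toDisk t).2
  exact Complex.continuous_ofReal.comp continuous_subtype_val

/-! ### Tail bounds and layer-cake integration -/

/-- The points of `[0,1)` at distance at most `u` from `1`. -/
def endSet (u : ℝ) : Set UnitIco := {t | 1 - (t : ℝ) ≤ u}

theorem measurableSet_endSet (u : ℝ) : MeasurableSet (endSet u) :=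
  measurableSet_le (by fun_prop) measurable_const

theorem endSet_eq_empty {u : ℝ} (h : u ≤ 0) : endSet u = ∅ := by
  ext t
  simp only [endSet, Set.mem_ofPred_eq, Set.mem_empty_iff_false, iff_false, not_le]
  exact h.trans_lt (one_sub_pos t)

theorem endSet_eq_univ {u : ℝ} (h : 1 ≤ u) : endSet u = Set.univ :=
  Set.eq_univ_of_forall fun t => by
    have := t.2.1
    simp only [endSet, Set.mem_ofPred_eq]
    linarith

/-- The bound `μ [1 - u, 1) log (e / u) ≤ K u²` for `0 < u ≤ s`. -/
def TailBound (μ : Measure UnitIco) (K s : ℝ) : Prop :=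
  ∀ u : ℝ, 0 < u → u ≤ s →
    μ (endSet u) * ENNReal.ofReal (1 - Real.log u) ≤ ENNReal.ofReal (K * u ^ 2)

/-- Tonelli on `{1 - t ≤ u}`: integrals of functions of `1 - t` written as tail integrals become
integrals of the tails of `μ`. -/
theorem lintegral_lintegral_Ici (μ : Measure UnitIco) [SFinite μ] {g : ℝ → ENNReal}
    (hg : Measurable g) :
    ∫⁻ t : UnitIco, (∫⁻ u in Set.Ici (1 - (t : ℝ)), g u) ∂μ = ∫⁻ u, g u * μ (endSet u) := by
  have h1 : ∀ t : UnitIco, ∫⁻ u in Set.Ici (1 - (t : ℝ)), g u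
      = ∫⁻ u, g u * (endSet u).indicator 1 t := by
    intro t
    rw [← lintegral_indicator measurableSet_Ici]
    refine lintegral_congr fun u => ?_
    by_cases h : 1 - (t : ℝ) ≤ u
    · rw [Set.indicator_of_mem (show u ∈ Set.Ici (1 - (t : ℝ)) from h),
        Set.indicator_of_mem (show t ∈ endSet u from h)]
      simp
    · rw [Set.indicator_of_notMem (show u ∉ Set.Ici (1 - (t : ℝ)) from h),
        Set.indicator_of_notMem (show t ∉ endSet u from h), mul_zero]
  have hm : Measurable (Function.uncurry fun (t : UnitIco) (u : ℝ) =>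
      g u * (endSet u).indicator (1 : UnitIco → ENNReal) t) := by
    have h2 : (Function.uncurry fun (t : UnitIco) (u : ℝ) =>
        g u * (endSet u).indicator (1 : UnitIco → ENNReal) t)
        = fun p : UnitIco × ℝ =>
          g p.2 * ({p : UnitIco × ℝ | 1 - (p.1 : ℝ) ≤ p.2}.indicator 1 p) := by
      funext p
      rfl
    rw [h2]
    refine (hg.comp measurable_snd).mul (measurable_one.indicator ?_)
    exact measurableSet_le (by fun_prop) measurable_snd
  simp_rw [h1]
  rw [lintegral_lintegral_swap hm.aemeasurable]
  refine lintegral_congr fun u => ?_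
  rw [lintegral_const_mul _ (measurable_one.indicator (measurableSet_endSet u)),
    lintegral_indicator_one (measurableSet_endSet u)]

theorem measure_endSet_le_of_tailBound {μ : Measure UnitIco} {K s : ℝ} (h : TailBound μ K s)
    (hs1 : s ≤ 1) {u : ℝ} (hu : 0 < u) (hus : u ≤ s) :
    μ (endSet u) ≤ ENNReal.ofReal (K * u ^ 2) := by
  refine le_trans ?_ (h u hu hus)
  have : (1 : ENNReal) ≤ ENNReal.ofReal (1 - Real.log u) := by
    rw [ENNReal.one_le_ofReal]
    linarith [Real.log_nonpos hu.le (hus.trans hs1)]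
  simpa using mul_le_mul_right this (μ (endSet u))

/-- Write `log(e/(1 - t)) = log(e/s) + ∫ du/u` over `[1 - t, s]`. The first term costs `K s²` by the
tail bound at `s`. The second costs `∫ u⁻¹ μ[1 - u, 1) du ≤ ∫ K u du` over `[0, s]`, bounded crudely
by `K s²`. -/
theorem lintegral_endSet_logWeight_le {μ : Measure UnitIco} [SFinite μ] {K s : ℝ} (hK : 0 ≤ K)
    (hs : 0 < s) (hs1 : s ≤ 1) (h : TailBound μ K s) :
    ∫⁻ t in endSet s, ENNReal.ofReal (logWeight t) ∂μ ≤ ENNReal.ofReal (2 * K * s ^ 2) := by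
  set g : ℝ → ENNReal := (Set.Iic s).indicator fun u => ENNReal.ofReal u⁻¹
  have hg : Measurable g := (by fun_prop : Measurable fun u : ℝ => ENNReal.ofReal u⁻¹).indicator
    measurableSet_Iic
  have hpt : ∀ t ∈ endSet s, ENNReal.ofReal (logWeight t)
      = ENNReal.ofReal (1 - Real.log s) + ∫⁻ u in Set.Ici (1 - (t : ℝ)), g u := by
    intro t ht
    have ht0 := one_sub_pos t
    have hts : 1 - (t : ℝ) ≤ s := ht
    have h1 : ∫⁻ u in Set.Ici (1 - (t : ℝ)), g u
        = ENNReal.ofReal (Real.log s - Real.log (1 - (t : ℝ))) := by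
      rw [lintegral_indicator measurableSet_Iic, Measure.restrict_restrict measurableSet_Iic,
        Set.Iic_inter_Ici, ← Real.log_div hs.ne' ht0.ne', ← integral_inv_of_pos ht0 hs,
        intervalIntegral.integral_of_le hts, ← integral_Icc_eq_integral_Ioc,
        ofReal_integral_eq_lintegral_ofReal]
      · refine (ContinuousOn.integrableOn_compact isCompact_Icc ?_)
        exact continuousOn_inv₀.mono fun x hx => (ht0.trans_le hx.1).ne'
      · refine (ae_restrict_mem measurableSet_Icc).mono fun x hx => ?_
        exact inv_nonneg.mpr (ht0.le.trans hx.1)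
    rw [h1, ← ENNReal.ofReal_add, logWeight_eq]
    · congr 1
      ring
    · linarith [Real.log_nonpos hs.le hs1]
    · linarith [Real.log_le_log ht0 hts]
  rw [setLIntegral_congr_fun (measurableSet_endSet s) hpt,
    lintegral_add_left measurable_const, setLIntegral_const, mul_comm]
  have h2 : ∫⁻ t in endSet s, (∫⁻ u in Set.Ici (1 - (t : ℝ)), g u) ∂μ
      ≤ ENNReal.ofReal (K * s ^ 2) := by
    refine (setLIntegral_le_lintegral _ _).trans ?_
    rw [lintegral_lintegral_Ici μ hg]
    calc ∫⁻ u, g u * μ (endSet u)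
        ≤ ∫⁻ u, (Set.Icc 0 s).indicator (fun _ => ENNReal.ofReal (K * s)) u := by
          refine lintegral_mono fun u => ?_
          rcases le_or_gt u 0 with hu | hu
          · simp [endSet_eq_empty hu]
          rcases lt_or_ge s u with hsu | hsu
          · simp [g, Set.indicator, hsu.not_ge]
          · simp only [g, Set.indicator, Set.mem_Iic, hsu, Set.mem_Icc, hu.le, and_self, if_true]
            refine (mul_le_mul_right (measure_endSet_le_of_tailBound h hs1 hu hsu) _).trans ?_
            rw [← ENNReal.ofReal_mul (inv_nonneg.mpr hu.le)]
            refine ENNReal.ofReal_le_ofReal ?_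
            have : u⁻¹ * (K * u ^ 2) = K * u := by
              field_simp
            rw [this]
            gcongr
      _ = ENNReal.ofReal (K * s ^ 2) := by
          rw [lintegral_indicator measurableSet_Icc, setLIntegral_const, Real.volume_Icc, sub_zero,
            ← ENNReal.ofReal_mul (by positivity)]
          congr 1
          ring
  calc _ ≤ ENNReal.ofReal (K * s ^ 2) + ENNReal.ofReal (K * s ^ 2) := add_le_add (h s hs le_rfl) h2
    _ = _ := by
      rw [← ENNReal.ofReal_add (by positivity) (by positivity)]
      congr 1
      ring

theorem lintegral_Ici_rpow {a c : ℝ} (ha : a < -1) (hc : 0 < c) :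
    ∫⁻ u in Set.Ici c, ENNReal.ofReal (u ^ a) = ENNReal.ofReal (-c ^ (a + 1) / (a + 1)) := by
  rw [← integral_Ioi_rpow_of_lt ha hc, setLIntegral_congr Ioi_ae_eq_Ici.symm,
    ofReal_integral_eq_lintegral_ofReal (integrableOn_Ioi_rpow_of_lt ha hc)]
  exact (ae_restrict_mem measurableSet_Ioi).mono fun x hx => Real.rpow_nonneg (hc.trans hx).le _

/-- The previous estimate says that `logWeight · μ` on `endSet s` has tails at most `2K u²`. A
second layer cake then gives `∫ 3u⁻⁴ · 2K u² du` over `u ≥ 1 - r`, which is `6K/(1 - r)`. -/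
theorem lintegral_endSet_logWeight_mul_le {μ : Measure UnitIco} [SFinite μ] {K s r : ℝ}
    (hK : 0 ≤ K) (hs : 0 < s) (hs1 : s ≤ 1) (hr0 : 0 ≤ r) (hr : r < 1) (h : TailBound μ K s) :
    ∫⁻ t in endSet s, ENNReal.ofReal (logWeight t) * ENNReal.ofReal ((1 - t * r) ^ 3)⁻¹ ∂μ
      ≤ ENNReal.ofReal (6 * K / (1 - r)) := by
  have hr' : 0 < 1 - r := by linarith
  have hw : Measurable fun t : UnitIco => ENNReal.ofReal (logWeight t) :=
    measurable_logWeight.ennreal_ofReal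
  set ν : Measure UnitIco := (μ.restrict (endSet s)).withDensity
    fun t => ENNReal.ofReal (logWeight t)
  have hν : ∀ u, 0 < u → ν (endSet u) ≤ ENNReal.ofReal (2 * K * u ^ 2) := by
    intro u hu
    rw [withDensity_apply _ (measurableSet_endSet u),
      Measure.restrict_restrict (measurableSet_endSet u)]
    have hm : 0 < min u s := lt_min hu hs
    refine (lintegral_mono_set (t := endSet (min u s)) fun t ht => le_min (α := ℝ) ht.1 ht.2).trans ?_
    refine (lintegral_endSet_logWeight_le hK hm ((min_le_right _ _).trans hs1)
      fun v hv hvs => h v hv (hvs.trans (min_le_right _ _))).trans ?_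
    gcongr
    exact min_le_left _ _
  set g : ℝ → ENNReal := (Set.Ici (1 - r)).indicator fun u => ENNReal.ofReal (3 * u ^ (-4 : ℝ))
  have hg : Measurable g := (by fun_prop :
    Measurable fun u : ℝ => ENNReal.ofReal (3 * u ^ (-4 : ℝ))).indicator measurableSet_Ici
  have hpt : ∀ t : UnitIco, ENNReal.ofReal ((1 - t * r) ^ 3)⁻¹
      ≤ ∫⁻ u in Set.Ici (1 - (t : ℝ)), g u := by
    intro t
    have ht0 := one_sub_pos t
    -- The integral of `3u⁻⁴` over `u ≥ max (1 - r) (1 - t)` is the inverse cube of this maximum. It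
    -- dominates `(1 - tr)⁻³` because both entries are at most `1 - tr`.
    have hm : 0 < max (1 - r) (1 - (t : ℝ)) := lt_max_of_lt_left hr'
    rw [lintegral_indicator measurableSet_Ici, Measure.restrict_restrict measurableSet_Ici,
      Set.Ici_inter_Ici]
    simp_rw [ENNReal.ofReal_mul (show (0 : ℝ) ≤ 3 by norm_num)]
    rw [lintegral_const_mul _ (by fun_prop), lintegral_Ici_rpow (by norm_num) hm,
      ← ENNReal.ofReal_mul (by norm_num)]
    refine ENNReal.ofReal_le_ofReal ?_
    have h1 : 3 * (-max (1 - r) (1 - (t : ℝ)) ^ (-4 + 1 : ℝ) / (-4 + 1))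
        = (max (1 - r) (1 - (t : ℝ)) ^ 3)⁻¹ := by
      have : (-4 + 1 : ℝ) = -((3 : ℕ) : ℝ) := by norm_num
      rw [this, Real.rpow_neg hm.le, Real.rpow_natCast]
      push_cast
      ring
    rw [h1]
    gcongr
    refine max_le ?_ ?_ <;> nlinarith [t.2.1, t.2.2]
  have hmeas : Measurable fun t : UnitIco => ENNReal.ofReal ((1 - (t : ℝ) * r) ^ 3)⁻¹ := by
    fun_prop
  calc ∫⁻ t in endSet s, ENNReal.ofReal (logWeight t) * ENNReal.ofReal ((1 - t * r) ^ 3)⁻¹ ∂μ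
      = ∫⁻ t, ENNReal.ofReal ((1 - (t : ℝ) * r) ^ 3)⁻¹ ∂ν := by
        rw [lintegral_withDensity_eq_lintegral_mul _ hw hmeas]
        rfl
    _ ≤ ∫⁻ t : UnitIco, (∫⁻ u in Set.Ici (1 - (t : ℝ)), g u) ∂ν := lintegral_mono hpt
    _ = ∫⁻ u, g u * ν (endSet u) := lintegral_lintegral_Ici ν hg
    _ ≤ ∫⁻ u, (Set.Ici (1 - r)).indicator
          (fun u => ENNReal.ofReal (6 * K) * ENNReal.ofReal (u ^ (-2 : ℝ))) u := by
        refine lintegral_mono fun u => ?_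
        by_cases hu : 1 - r ≤ u
        · have hu0 : 0 < u := hr'.trans_le hu
          simp only [g, Set.indicator, Set.mem_Ici, hu, if_true]
          refine (mul_le_mul_right (hν u hu0) _).trans ?_
          rw [← ENNReal.ofReal_mul (by positivity), ← ENNReal.ofReal_mul (by positivity)]
          refine ENNReal.ofReal_le_ofReal (le_of_eq ?_)
          have h4 : u ^ (-2 : ℝ) = u ^ (-4 : ℝ) * u ^ 2 := by
            rw [← Real.rpow_natCast, ← Real.rpow_add hu0]
            norm_num
          rw [h4]
          ring
        · simp [g, Set.indicator, hu]
    _ = ENNReal.ofReal (6 * K / (1 - r)) := by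
        rw [lintegral_indicator measurableSet_Ici, lintegral_const_mul _ (by fun_prop),
          lintegral_Ici_rpow (by norm_num) hr', ← ENNReal.ofReal_mul (by positivity)]
        congr 1
        have : (-2 + 1 : ℝ) = -1 := by norm_num
        rw [this, Real.rpow_neg_one]
        field_simp

theorem TailBound.mono {μ : Measure UnitIco} {K L s : ℝ} (h : TailBound μ K s) (hKL : K ≤ L) :
    TailBound μ L s := fun u hu hus => (h u hu hus).trans (by gcongr)

/-- For a finite measure a tail bound near the endpoint extends to all scales. -/
theorem TailBound.exists_one {μ : Measure UnitIco} [IsFiniteMeasure μ] {K s : ℝ} (hs : 0 < s)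
    (h : TailBound μ K s) : ∃ L, 0 ≤ L ∧ TailBound μ L 1 := by
  set M := μ.real Set.univ * (1 - Real.log s) / s ^ 2
  refine ⟨max 0 (max K M), le_max_left _ _, fun u hu hu1 => ?_⟩
  rcases le_or_gt u s with hus | hus
  · refine (h u hu hus).trans ?_
    gcongr
    exact (le_max_left _ _).trans (le_max_right _ _)
  · have hlog : Real.log s ≤ Real.log u := Real.log_le_log hs hus.le
    have h1 : 0 ≤ 1 - Real.log u := by linarith [Real.log_nonpos hu.le hu1]
    calc μ (endSet u) * ENNReal.ofReal (1 - Real.log u)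
        ≤ μ Set.univ * ENNReal.ofReal (1 - Real.log s) := by
          gcongr
          exact Set.subset_univ _
      _ = ENNReal.ofReal (M * s ^ 2) := by
          rw [← ofReal_measureReal, ← ENNReal.ofReal_mul measureReal_nonneg]
          congr 1
          simp only [M]
          field_simp
      _ ≤ _ := by
          have hM : 0 ≤ M := by
            have : 0 ≤ 1 - Real.log s := by linarith
            positivity
          have : M ≤ max 0 (max K M) := (le_max_right _ _).trans (le_max_right _ _)
          gcongr

/-! ### The integral transform and its Bloch norm -/

section

/-- The kernel `(1 - t z)^(-α)`. -/
def kernel (α : ℝ) (z : ℂ) (t : UnitIco) : ℂ := (1 - ((t : ℝ) : ℂ) * z) ^ (-α : ℂ)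

/-- The transform `z ↦ ∫ φ(t) (1 - t z)^(-α) dμ(t)` of a function on `[0,1)`. -/
def transform (μ : Measure UnitIco) (α : ℝ) (φ : UnitIco → ℂ) (z : Disk) : ℂ :=
  ∫ t, φ t * kernel α z t ∂μ

theorem norm_ofReal_mul_le (t : UnitIco) (z : ℂ) : ‖((t : ℝ) : ℂ) * z‖ = t * ‖z‖ := by
  rw [norm_mul, Complex.norm_real, Real.norm_eq_abs, abs_of_nonneg t.2.1]

theorem one_sub_mul_le_norm (t : UnitIco) (z : ℂ) : 1 - t * ‖z‖ ≤ ‖1 - ((t : ℝ) : ℂ) * z‖ := by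
  have h := norm_sub_norm_le (1 : ℂ) (((t : ℝ) : ℂ) * z)
  rwa [norm_ofReal_mul_le, norm_one] at h

theorem one_sub_norm_le_norm (t : UnitIco) (z : ℂ) : 1 - ‖z‖ ≤ ‖1 - ((t : ℝ) : ℂ) * z‖ := by
  refine le_trans ?_ (one_sub_mul_le_norm t z)
  nlinarith [norm_nonneg z, t.2.2]

theorem one_sub_mem_slitPlane (t : UnitIco) {z : ℂ} (hz : ‖z‖ < 1) :
    1 - ((t : ℝ) : ℂ) * z ∈ Complex.slitPlane := by
  left
  have h := (Complex.re_le_norm (((t : ℝ) : ℂ) * z)).trans_eq (norm_ofReal_mul_le t z)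
  have h2 : t * ‖z‖ ≤ ‖z‖ := mul_le_of_le_one_left (norm_nonneg z) t.2.2.le
  rw [Complex.sub_re, Complex.one_re]
  linarith

theorem measurable_kernel (α : ℝ) (z : ℂ) : Measurable (kernel α z) := by
  unfold kernel
  fun_prop

theorem norm_kernel (α : ℝ) (z : ℂ) (t : UnitIco) :
    ‖kernel α z t‖ = ‖1 - ((t : ℝ) : ℂ) * z‖ ^ (-α) := by
  rw [kernel, ← Complex.ofReal_neg, Complex.norm_cpow_real]

theorem norm_kernel_le {α : ℝ} (hα : 0 ≤ α) {z : ℂ} {c : ℝ} (hc : 0 < c) (hz : c ≤ 1 - ‖z‖)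
    (t : UnitIco) : ‖kernel α z t‖ ≤ c ^ (-α) := by
  rw [norm_kernel]
  exact Real.rpow_le_rpow_of_nonpos hc (hz.trans (one_sub_norm_le_norm t z)) (neg_nonpos.mpr hα)

theorem hasDerivAt_kernel (α : ℝ) (t : UnitIco) {z : ℂ} (hz : ‖z‖ < 1) :
    HasDerivAt (fun w => kernel α w t) (α * t * kernel (α + 1) z t) z := by
  have h := (((hasDerivAt_id z).const_mul ((t : ℝ) : ℂ)).const_sub 1).cpow_const
    (c := (-α : ℂ)) (one_sub_mem_slitPlane t hz)
  have : (-(α : ℂ) - 1) = -((α + 1 : ℝ) : ℂ) := by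
    push_cast
    ring
  rw [this] at h
  refine h.congr_deriv ?_
  rw [kernel, id]
  ring

variable {μ : Measure UnitIco} {α : ℝ} {φ : UnitIco → ℂ}

theorem integrable_mul_kernel (hα : 0 ≤ α) (hφ : Integrable φ μ) (z : Disk) :
    Integrable (fun t => φ t * kernel α z t) μ := by
  have hz : 0 < 1 - ‖(z : ℂ)‖ := sub_pos.mpr (mem_ball_zero_iff.mp z.2)
  exact hφ.mul_bdd (measurable_kernel α z).aestronglyMeasurable
    (Eventually.of_forall fun t => norm_kernel_le hα hz le_rfl t)

theorem hasDerivAt_transform (hα : 0 ≤ α) (hφ : Integrable φ μ) (z : Disk) :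
    HasDerivAt (extend (transform μ α φ)) (∫ t, φ t * (α * t * kernel (α + 1) z t) ∂μ) z := by
  have hz : ‖(z : ℂ)‖ < 1 := mem_ball_zero_iff.mp z.2
  -- Half the distance to the circle: on the ball of this radius the kernel is bounded uniformly in
  -- `t`, so a multiple of `|φ|` dominates the differentiated integrand.
  set c := (1 - ‖(z : ℂ)‖) / 2
  have hc : 0 < c := by
    simp only [c]
    linarith
  have hball : ∀ w ∈ Metric.ball (z : ℂ) c, c ≤ 1 - ‖w‖ := by
    intro w hw
    have h1 : ‖w - z‖ < c := mem_ball_iff_norm.mp hw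
    have h2 : ‖w‖ ≤ ‖w - z‖ + ‖(z : ℂ)‖ := by simpa using norm_add_le (w - z) (z : ℂ)
    simp only [c] at h1 ⊢
    linarith
  have hnhds : Metric.ball (z : ℂ) c ∈ 𝓝 (z : ℂ) := Metric.ball_mem_nhds _ hc
  have key := (hasDerivAt_integral_of_dominated_loc_of_deriv_le (μ := μ)
    (F := fun w t => φ t * kernel α w t) (F' := fun w t => φ t * (α * t * kernel (α + 1) w t))
    (bound := fun t => ‖φ t‖ * (α * c ^ (-(α + 1)))) hnhds
    (Eventually.of_forall fun w => hφ.1.mul (measurable_kernel α w).aestronglyMeasurable)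
    (integrable_mul_kernel hα hφ z)
    (hφ.1.mul ((by fun_prop : Measurable fun t : UnitIco => (α * ((t : ℝ) : ℂ))).mul
      (measurable_kernel (α + 1) z)).aestronglyMeasurable)
    (Eventually.of_forall fun t w hw => ?_) (hφ.norm.mul_const _)
    (Eventually.of_forall fun t w hw => ?_)).2
  · refine key.congr_of_eventuallyEq ?_
    filter_upwards [Metric.isOpen_ball.mem_nhds z.2] with w hw
    exact extend_apply (transform μ α φ) ⟨w, hw⟩
  · rw [norm_mul, norm_mul, norm_mul, Complex.norm_real, Complex.norm_real, Real.norm_eq_abs,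
      Real.norm_eq_abs, abs_of_nonneg hα, abs_of_nonneg t.2.1]
    have h1 := norm_kernel_le (by linarith : 0 ≤ α + 1) hc (hball w hw) t
    have h2 : α * t ≤ α := mul_le_of_le_one_right hα t.2.2.le
    have h3 : 0 ≤ α * t := mul_nonneg hα t.2.1
    gcongr
  · have hw1 : ‖w‖ < 1 := by
      have := hball w hw
      linarith
    exact (hasDerivAt_kernel α t hw1).const_mul (φ t)

theorem isAnalytic_transform (hα : 0 ≤ α) (hφ : Integrable φ μ) :
    IsAnalytic (transform μ α φ) := fun z hz =>
  (hasDerivAt_transform hα hφ ⟨z, hz⟩).differentiableAt.differentiableWithinAt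

theorem diskDeriv_transform (hα : 0 ≤ α) (hφ : Integrable φ μ) (z : Disk) :
    diskDeriv (transform μ α φ) z = ∫ t, φ t * (α * t * kernel (α + 1) z t) ∂μ :=
  (hasDerivAt_transform hα hφ z).deriv

/-- Here `α ≥ 2` enters: `(1 - r)^(α-1) = (1 - r)(1 - r)^(α-2) ≤ (1 - r)(1 - tr)^(α-2)`, and the
last factor lowers the kernel exponent from `α + 1` to `3`. -/
theorem weight_mul_kernel_le (hα : 2 ≤ α) (z : Disk) (t : UnitIco) :
    (1 - ‖(z : ℂ)‖ ^ 2) ^ (α - 1) * ‖(α * t * kernel (α + 1) z t : ℂ)‖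
      ≤ α * 2 ^ (α - 1) * (1 - ‖(z : ℂ)‖) * ((1 - t * ‖(z : ℂ)‖) ^ 3)⁻¹ := by
  set r := ‖(z : ℂ)‖
  have hr : r < 1 := mem_ball_zero_iff.mp z.2
  have hr0 : 0 ≤ r := norm_nonneg _
  have hr' : 0 < 1 - r := by linarith
  have ht0 := t.2.1
  have ht1 := t.2.2
  have hd : 1 - r ≤ 1 - t * r := by nlinarith
  have hd0 : 0 < 1 - t * r := hr'.trans_le hd
  rw [norm_mul, norm_mul, Complex.norm_real, Complex.norm_real, Real.norm_eq_abs,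
    Real.norm_eq_abs, abs_of_nonneg ht0, abs_of_nonneg (by linarith : 0 ≤ α), norm_kernel]
  have h1 : (1 - r ^ 2) ^ (α - 1) ≤ 2 ^ (α - 1) * ((1 - r) * (1 - t * r) ^ (α - 2)) := by
    have h2 : (1 - r) ^ (α - 1) = (1 - r) * (1 - r) ^ (α - 2) := by
      rw [← Real.rpow_one_add' hr'.le (by linarith)]
      congr 1
      ring
    calc (1 - r ^ 2) ^ (α - 1) ≤ (2 * (1 - r)) ^ (α - 1) :=
          Real.rpow_le_rpow (by nlinarith) (by nlinarith) (by linarith)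
      _ = 2 ^ (α - 1) * ((1 - r) * (1 - r) ^ (α - 2)) := by
          rw [Real.mul_rpow (by norm_num) hr'.le, h2]
      _ ≤ _ := by
          gcongr
  have h3 : ‖1 - ((t : ℝ) : ℂ) * (z : ℂ)‖ ^ (-(α + 1)) ≤ (1 - t * r) ^ (-(α + 1)) :=
    Real.rpow_le_rpow_of_nonpos hd0 (one_sub_mul_le_norm t z) (by linarith)
  have h4 : α * t ≤ α := mul_le_of_le_one_right (by linarith) ht1.le
  have h5 : 0 ≤ (1 - r ^ 2) ^ (α - 1) := Real.rpow_nonneg (by nlinarith) _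
  have h6 : 0 ≤ α * t := mul_nonneg (by linarith) ht0
  calc _ ≤ (2 ^ (α - 1) * ((1 - r) * (1 - t * r) ^ (α - 2))) *
        (α * (1 - t * r) ^ (-(α + 1))) := by gcongr
    _ = α * 2 ^ (α - 1) * (1 - r) * ((1 - t * r) ^ (α - 2) * (1 - t * r) ^ (-(α + 1))) := by ring
    _ = _ := by
      rw [← Real.rpow_add hd0]
      have : α - 2 + -(α + 1) = -((3 : ℕ) : ℝ) := by
        push_cast
        ring
      rw [this, Real.rpow_neg hd0.le, Real.rpow_natCast]

theorem ofReal_blochWeight_transform_le (hα : 2 ≤ α) (hφ : Integrable φ μ) (z : Disk) :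
    ENNReal.ofReal (blochWeight (α - 1) (transform μ α φ) z)
      ≤ ENNReal.ofReal (α * 2 ^ (α - 1) * (1 - ‖(z : ℂ)‖)) *
        ∫⁻ t, ‖φ t‖ₑ * ENNReal.ofReal ((1 - t * ‖(z : ℂ)‖) ^ 3)⁻¹ ∂μ := by
  have hr : 0 < 1 - ‖(z : ℂ)‖ := sub_pos.mpr (mem_ball_zero_iff.mp z.2)
  have hw : 0 ≤ (1 - ‖(z : ℂ)‖ ^ 2) ^ (α - 1) := Real.rpow_nonneg z.one_sub_sq_pos.le _
  have hc : 0 ≤ α * 2 ^ (α - 1) * (1 - ‖(z : ℂ)‖) := by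
    have : 0 ≤ α := by linarith
    positivity
  rw [blochWeight, diskDeriv_transform (by linarith) hφ, ENNReal.ofReal_mul hw, ofReal_norm]
  calc _ ≤ ENNReal.ofReal ((1 - ‖(z : ℂ)‖ ^ 2) ^ (α - 1)) *
        ∫⁻ t, ‖φ t * (α * t * kernel (α + 1) z t)‖ₑ ∂μ := by
        gcongr
        exact enorm_integral_le_lintegral_enorm _
    _ = ∫⁻ t, ENNReal.ofReal ((1 - ‖(z : ℂ)‖ ^ 2) ^ (α - 1)) *
          ‖φ t * (α * t * kernel (α + 1) z t)‖ₑ ∂μ :=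
        (lintegral_const_mul' _ _ ENNReal.ofReal_ne_top).symm
    _ ≤ ∫⁻ t, ENNReal.ofReal (α * 2 ^ (α - 1) * (1 - ‖(z : ℂ)‖)) *
          (‖φ t‖ₑ * ENNReal.ofReal ((1 - t * ‖(z : ℂ)‖) ^ 3)⁻¹) ∂μ := by
        refine lintegral_mono fun t => ?_
        have h := ENNReal.ofReal_le_ofReal (weight_mul_kernel_le hα z t)
        rw [ENNReal.ofReal_mul hw, ENNReal.ofReal_mul hc, ofReal_norm] at h
        rw [enorm_mul, mul_left_comm, mul_left_comm (ENNReal.ofReal (_ * _))]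
        gcongr
    _ = _ := lintegral_const_mul' _ _ ENNReal.ofReal_ne_top

theorem integrable_of_le_logWeight (hμ : Integrable logWeight μ) {M : ℝ}
    (hm : AEStronglyMeasurable φ μ) (h : ∀ t, ‖φ t‖ ≤ M * logWeight t) : Integrable φ μ :=
  (hμ.const_mul M).mono' hm (Eventually.of_forall h)

/-- The bound `∫ |φ(t)| (1 - t r)⁻³ dμ(t) ≤ B / (1 - r)` for `0 ≤ r < 1`. -/
def CubicBound (μ : Measure UnitIco) (φ : UnitIco → ℂ) (B : ℝ) : Prop :=
  ∀ r : ℝ, 0 ≤ r → r < 1 →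
    ∫⁻ t, ‖φ t‖ₑ * ENNReal.ofReal ((1 - t * r) ^ 3)⁻¹ ∂μ ≤ ENNReal.ofReal (B / (1 - r))

/-- The factor `1 - r` left over from the weight cancels the `1/(1 - r)` of the cubic bound. -/
theorem CubicBound.blochWeight_le {B : ℝ} (hB : 0 ≤ B) (h : CubicBound μ φ B) (hα : 2 ≤ α)
    (hφ : Integrable φ μ) (z : Disk) :
    blochWeight (α - 1) (transform μ α φ) z ≤ α * 2 ^ (α - 1) * B := by
  have hα0 : 0 ≤ α := by linarith
  have hr : 0 < 1 - ‖(z : ℂ)‖ := sub_pos.mpr (mem_ball_zero_iff.mp z.2)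
  have h1 := ofReal_blochWeight_transform_le hα hφ z
  have h2 := h _ (norm_nonneg (z : ℂ)) (mem_ball_zero_iff.mp z.2)
  refine (ENNReal.ofReal_le_ofReal_iff (by positivity)).mp ?_
  refine (h1.trans (mul_le_mul_right h2 _)).trans_eq ?_
  rw [← ENNReal.ofReal_mul (by positivity)]
  congr 1
  field_simp

theorem CubicBound.norm_zero_le {B : ℝ} (hB : 0 ≤ B) (h : CubicBound μ φ B) :
    ‖transform μ α φ Disk.zero‖ ≤ B := by
  have h1 : ∀ t, φ t * kernel α (Disk.zero : ℂ) t = φ t := fun t => by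
    simp [kernel, Disk.zero]
  have h2 := h 0 le_rfl one_pos
  simp only [mul_zero, sub_zero, one_pow, inv_one, ENNReal.ofReal_one, mul_one, div_one] at h2
  refine (ENNReal.ofReal_le_ofReal_iff hB).mp ?_
  rw [ofReal_norm]
  simp only [transform, h1]
  exact (enorm_integral_le_lintegral_enorm _).trans h2

theorem CubicBound.norm_le {B : ℝ} (hB : 0 ≤ B) (h : CubicBound μ φ B) (hα : 2 ≤ α)
    (hφ : Integrable φ μ) {g : Bloch (α - 1)} (hg : g.toFun = transform μ α φ) :
    ‖g‖ ≤ (1 + α * 2 ^ (α - 1)) * B := by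
  have h1 := g.norm_le_of_blochWeight_le (C := α * 2 ^ (α - 1) * B) fun z => by
    rw [hg]
    exact h.blochWeight_le hB hα hφ z
  have h2 := h.norm_zero_le (α := α) hB
  rw [← hg] at h2
  linarith

theorem CubicBound.mem {B : ℝ} (hB : 0 ≤ B) (h : CubicBound μ φ B) (hα : 2 ≤ α)
    (hφ : Integrable φ μ) : transform μ α φ ∈ blochSubmodule (α - 1) := by
  refine ⟨isAnalytic_transform (by linarith) hφ, α * 2 ^ (α - 1) * B, ?_⟩
  rintro _ ⟨z, rfl⟩
  exact h.blochWeight_le hB hα hφ z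

theorem setLIntegral_endSet_le [SFinite μ] {K M s r : ℝ} (hK : 0 ≤ K) (hM : 0 ≤ M) (hs : 0 < s)
    (hs1 : s ≤ 1) (hr0 : 0 ≤ r) (hr : r < 1) (hT : TailBound μ K s)
    (h : ∀ t, ‖φ t‖ ≤ M * logWeight t) :
    ∫⁻ t in endSet s, ‖φ t‖ₑ * ENNReal.ofReal ((1 - t * r) ^ 3)⁻¹ ∂μ
      ≤ ENNReal.ofReal (6 * K * M / (1 - r)) := by
  have h3 := lintegral_endSet_logWeight_mul_le hK hs hs1 hr0 hr hT
  rw [mul_comm (6 * K), mul_div_assoc, ENNReal.ofReal_mul hM]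
  refine le_trans ?_ (mul_le_mul_right h3 _)
  rw [← lintegral_const_mul' _ _ ENNReal.ofReal_ne_top]
  refine lintegral_mono fun t => ?_
  rw [← mul_assoc, ← ENNReal.ofReal_mul hM, ← ofReal_norm]
  gcongr
  exact h t

theorem cubicBound_of_le_logWeight [SFinite μ] {K M : ℝ} (hK : 0 ≤ K) (hM : 0 ≤ M)
    (hT : TailBound μ K 1) (h : ∀ t, ‖φ t‖ ≤ M * logWeight t) :
    CubicBound μ φ (6 * K * M) := by
  intro r hr0 hr
  have h1 := setLIntegral_endSet_le hK hM one_pos le_rfl hr0 hr hT h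
  rwa [endSet_eq_univ le_rfl, Measure.restrict_univ] at h1

theorem transform_add (hα : 0 ≤ α) {ψ : UnitIco → ℂ} (hφ : Integrable φ μ) (hψ : Integrable ψ μ) :
    transform μ α (φ + ψ) = transform μ α φ + transform μ α ψ := by
  funext z
  simp only [transform, Pi.add_apply, add_mul]
  exact integral_add (integrable_mul_kernel hα hφ z) (integrable_mul_kernel hα hψ z)

theorem transform_smul (c : ℂ) : transform μ α (c • φ) = c • transform μ α φ := by
  funext z
  simp only [transform, Pi.smul_apply, smul_eq_mul, mul_assoc]
  exact integral_const_mul c _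

theorem hilbertIntegrand_eq (f : Disk → ℂ) (z : Disk) :
    hilbertIntegrand α f z = fun t => f (toDisk t) * kernel α z t := by
  funext t
  rw [hilbertIntegrand, kernel, Complex.cpow_neg, div_eq_mul_inv]

theorem isIntegralHilbert_transform (hα : 0 ≤ α) {f : Disk → ℂ}
    (hf : Integrable (fun t => f (toDisk t)) μ) :
    IsIntegralHilbert μ α f (transform μ α fun t => f (toDisk t)) := by
  refine ⟨isAnalytic_transform hα hf, fun z => ?_⟩
  rw [hilbertIntegrand_eq]
  exact ⟨integrable_mul_kernel hα hf z, rfl⟩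

theorem IsIntegralHilbert.eq_transform {f g : Disk → ℂ} (h : IsIntegralHilbert μ α f g) :
    g = transform μ α fun t => f (toDisk t) := by
  funext z
  rw [(h.2 z).2, hilbertIntegrand_eq]
  rfl

end

/-! ### Sufficiency: boundedness and finite-rank approximation -/

section

variable {μ : Measure UnitIco} {α : ℝ}

/-- The source `V` is left general so that this serves both the Bloch space, through radial
restriction, and the finite-dimensional spaces of sampled values. -/
theorem exists_transformCLM [SFinite μ] {K : ℝ} (hα : 2 ≤ α) (hμ : Integrable logWeight μ)
    (hK : 0 ≤ K) (hT : TailBound μ K 1) {V : Type*} [NormedAddCommGroup V] [NormedSpace ℂ V]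
    (Φ : V →ₗ[ℂ] UnitIco → ℂ) (hm : ∀ v, Measurable (Φ v))
    (hb : ∀ v t, ‖Φ v t‖ ≤ ‖v‖ * logWeight t) :
    ∃ T : V →L[ℂ] Bloch (α - 1), ∀ v, (T v).toFun = transform μ α (Φ v) := by
  have hα0 : 0 ≤ α := by linarith
  have hi : ∀ v, Integrable (Φ v) μ := fun v =>
    integrable_of_le_logWeight hμ (hm v).aestronglyMeasurable (hb v)
  have hc : ∀ v, CubicBound μ (Φ v) (6 * K * ‖v‖) := fun v =>
    cubicBound_of_le_logWeight hK (norm_nonneg v) hT (hb v)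
  let T : V →ₗ[ℂ] Bloch (α - 1) :=
    { toFun := fun v => ⟨transform μ α (Φ v), (hc v).mem (by positivity) hα (hi v)⟩
      map_add' := fun v w => Bloch.toFun_injective (by
        change transform μ α (Φ (v + w)) = transform μ α (Φ v) + transform μ α (Φ w)
        rw [map_add, transform_add hα0 (hi v) (hi w)])
      map_smul' := fun c v => Bloch.toFun_injective (by
        change transform μ α (Φ (c • v)) = c • transform μ α (Φ v)
        rw [map_smul, transform_smul]) }
  refine ⟨T.mkContinuous ((1 + α * 2 ^ (α - 1)) * (6 * K)) fun v => ?_, fun v => rfl⟩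
  rw [mul_assoc]
  exact (hc v).norm_le (by positivity) hα (hi v) rfl

/-- Restriction of Bloch functions to the radius `[0,1)`. -/
def radialRestriction : Bloch 1 →ₗ[ℂ] UnitIco → ℂ where
  toFun f t := f (toDisk t)
  map_add' _ _ := rfl
  map_smul' _ _ := rfl

theorem integrable_apply_toDisk (hμ : Integrable logWeight μ) (f : Bloch 1) :
    Integrable (fun t => f (toDisk t)) μ :=
  integrable_of_le_logWeight hμ f.continuous_apply_toDisk.measurable.aestronglyMeasurable
    f.norm_apply_toDisk_le

theorem exists_integralHilbert [SFinite μ] {K : ℝ} (hα : 2 ≤ α) (hμ : Integrable logWeight μ)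
    (hK : 0 ≤ K) (hT : TailBound μ K 1) :
    ∃ T : Bloch 1 →L[ℂ] Bloch (α - 1), ∀ f : Bloch 1, IsIntegralHilbert μ α f (T f) := by
  obtain ⟨T, hTr⟩ := exists_transformCLM hα hμ hK hT radialRestriction
    (fun f => f.continuous_apply_toDisk.measurable) fun f => f.norm_apply_toDisk_le
  refine ⟨T, fun f => ?_⟩
  rw [hTr]
  exact isIntegralHilbert_transform (by linarith) (integrable_apply_toDisk hμ f)

/-- The index of the cell `[j / (n + 1), (j + 1) / (n + 1))` that contains `t`. -/
def cellIndex (n : ℕ) (t : UnitIco) : Fin (n + 1) :=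
  ⟨⌊((n : ℝ) + 1) * t⌋₊, by
    rw [Nat.floor_lt (mul_nonneg (by positivity) t.2.1)]
    push_cast
    nlinarith [t.2.2, (n.cast_nonneg : (0 : ℝ) ≤ n)]⟩

/-- The left endpoint `j / (n + 1)` of a cell. -/
def cellPoint (n : ℕ) (j : Fin (n + 1)) : UnitIco :=
  ⟨(j : ℝ) / (n + 1), by positivity, by
    rw [div_lt_one (by positivity)]
    exact_mod_cast j.2⟩

theorem measurable_cellIndex (n : ℕ) : Measurable (cellIndex n) := by
  refine measurable_to_countable' fun j => ?_
  have h : cellIndex n ⁻¹' {j} = (fun t : UnitIco => ⌊((n : ℝ) + 1) * t⌋₊) ⁻¹' {(j : ℕ)} := by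
    ext t
    simp [cellIndex, Fin.ext_iff]
  rw [h]
  exact (Nat.measurable_floor.comp (by fun_prop)) (measurableSet_singleton _)

theorem cellPoint_cellIndex_le (n : ℕ) (t : UnitIco) : cellPoint n (cellIndex n t) ≤ t := by
  refine Subtype.coe_le_coe.mp ?_
  simp only [cellPoint, cellIndex]
  rw [div_le_iff₀ (by positivity), mul_comm (t : ℝ)]
  exact Nat.floor_le (mul_nonneg (by positivity) t.2.1)

theorem sub_cellPoint_le (n : ℕ) (t : UnitIco) :
    (t : ℝ) - cellPoint n (cellIndex n t) ≤ ((n : ℝ) + 1)⁻¹ := by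
  have hn : (0 : ℝ) < n + 1 := by positivity
  have h := (Nat.lt_floor_add_one (((n : ℝ) + 1) * t)).le
  simp only [cellPoint, cellIndex]
  rw [← one_div, sub_le_iff_le_add, ← add_div, le_div_iff₀ hn]
  linarith

/-- Sampling factors through `ℂ^(n+1)`, which forces compactness. -/
theorem exists_sampledOperator [SFinite μ] {K : ℝ} (hα : 2 ≤ α) (hμ : Integrable logWeight μ)
    (hK : 0 ≤ K) (hT : TailBound μ K 1) (n : ℕ) :
    ∃ S : Bloch 1 →L[ℂ] Bloch (α - 1), IsCompactOperator S ∧ ∀ f : Bloch 1,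
      (S f).toFun = transform μ α fun t => f (toDisk (cellPoint n (cellIndex n t))) := by
  let Φ : (Fin (n + 1) → ℂ) →ₗ[ℂ] UnitIco → ℂ :=
    { toFun := fun v t => v (cellIndex n t)
      map_add' := fun _ _ => rfl
      map_smul' := fun _ _ => rfl }
  obtain ⟨R, hR⟩ := exists_transformCLM hα hμ hK hT Φ
    (fun v => (measurable_of_finite v).comp (measurable_cellIndex n)) (fun v t =>
      (norm_le_pi_norm v _).trans (le_mul_of_one_le_right (norm_nonneg v) (one_le_logWeight t)))
  let L : Bloch 1 →L[ℂ] (Fin (n + 1) → ℂ) :=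
    ContinuousLinearMap.pi fun j => Bloch.eval zero_le_one (toDisk (cellPoint n j))
  refine ⟨R.comp L, ?_, fun f => hR (L f)⟩
  exact (isCompactOperator_of_locallyCompactSpace_dom L).clm_comp R

/-- On `endSet s` both values are at most `‖f‖ logWeight t`, as the sample point lies to the left of
`t`; hence `12K = 6K · 2`. Off `endSet s` the derivative bound contributes `s⁻¹`, the mesh `(n +
1)⁻¹` and the kernel `s⁻³`. -/
theorem cubicBound_sub_sampled [IsFiniteMeasure μ] {K s : ℝ} (hK : 0 ≤ K) (hs : 0 < s)
    (hs1 : s ≤ 1) (hT : TailBound μ K s) (f : Bloch 1) (n : ℕ) :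
    CubicBound μ (fun t => f (toDisk t) - f (toDisk (cellPoint n (cellIndex n t))))
      (‖f‖ * (12 * K + μ.real Set.univ / s ^ 4 * ((n : ℝ) + 1)⁻¹)) := by
  intro r hr0 hr
  have hr' : 0 < 1 - r := by linarith
  have hf := norm_nonneg f
  have hfar : ∀ t ∈ (endSet s)ᶜ,
      ‖f (toDisk t) - f (toDisk (cellPoint n (cellIndex n t)))‖ₑ *
        ENNReal.ofReal ((1 - t * r) ^ 3)⁻¹
      ≤ ENNReal.ofReal (‖f‖ * ((n : ℝ) + 1)⁻¹ / s ^ 4) := by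
    intro t ht
    have hts : s < 1 - (t : ℝ) := not_le.mp ht
    have hst : s ≤ 1 - t * r := by nlinarith [t.2.1]
    rw [← ofReal_norm, ← ENNReal.ofReal_mul (norm_nonneg _)]
    refine ENNReal.ofReal_le_ofReal ?_
    calc _ ≤ (‖f‖ * (1 - (t : ℝ))⁻¹ * ((t : ℝ) - cellPoint n (cellIndex n t))) *
          ((1 - t * r) ^ 3)⁻¹ := by
          have : 0 ≤ ((1 - t * r) ^ 3)⁻¹ := inv_nonneg.mpr (pow_nonneg (hs.le.trans hst) 3)
          gcongr
          exact f.norm_apply_toDisk_sub_le (cellPoint_cellIndex_le n t)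
      _ ≤ (‖f‖ * s⁻¹ * ((n : ℝ) + 1)⁻¹) * (s ^ 3)⁻¹ := by
          have h1 := sub_cellPoint_le n t
          have h2 : 0 ≤ (t : ℝ) - cellPoint n (cellIndex n t) :=
            sub_nonneg.mpr (cellPoint_cellIndex_le n t)
          have : 0 ≤ ((1 - t * r) ^ 3)⁻¹ := inv_nonneg.mpr (pow_nonneg (hs.le.trans hst) 3)
          gcongr
      _ = _ := by field_simp
  have hnear := setLIntegral_endSet_le (μ := μ)
    (φ := fun t => f (toDisk t) - f (toDisk (cellPoint n (cellIndex n t)))) hK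
    (by positivity : 0 ≤ 2 * ‖f‖) hs hs1 hr0 hr hT (fun t => by
      have h1 := f.norm_apply_toDisk_le t
      have h2 := f.norm_apply_toDisk_le (cellPoint n (cellIndex n t))
      have h3 := mul_le_mul_of_nonneg_left (logWeight_mono (cellPoint_cellIndex_le n t)) hf
      have h4 := norm_sub_le (f (toDisk t)) (f (toDisk (cellPoint n (cellIndex n t))))
      linarith)
  rw [← lintegral_add_compl _ (measurableSet_endSet s)]
  have hfar' := setLIntegral_mono_ae (μ := μ) (s := (endSet s)ᶜ) measurable_const.aemeasurable
    (Eventually.of_forall hfar)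
  rw [setLIntegral_const] at hfar'
  refine (add_le_add hnear (hfar'.trans (mul_le_mul_right
    (measure_mono (Set.subset_univ _)) _))).trans ?_
  rw [← ofReal_measureReal, ← ENNReal.ofReal_mul (by positivity),
    ← ENNReal.ofReal_add (by positivity) (by positivity)]
  refine ENNReal.ofReal_le_ofReal ?_
  -- The far part has no singularity in `r`; dividing by `1 - r ≤ 1` only enlarges it and gives the
  -- required form.
  have h5 : ‖f‖ * ((n : ℝ) + 1)⁻¹ / s ^ 4 * μ.real Set.univ
      ≤ ‖f‖ * ((n : ℝ) + 1)⁻¹ / s ^ 4 * μ.real Set.univ / (1 - r) :=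
    le_div_self (by positivity) hr' (by linarith)
  calc _ ≤ 6 * K * (2 * ‖f‖) / (1 - r) +
        ‖f‖ * ((n : ℝ) + 1)⁻¹ / s ^ 4 * μ.real Set.univ / (1 - r) := by gcongr
    _ = _ := by
      field_simp
      ring

theorem isCompactOperator_integralHilbert [IsFiniteMeasure μ] (hα : 2 ≤ α)
    (hμ : Integrable logWeight μ)
    (hT : ∀ ε : ℝ, 0 < ε → ∃ s : ℝ, 0 < s ∧ s ≤ 1 ∧ TailBound μ ε s)
    {T : Bloch 1 →L[ℂ] Bloch (α - 1)} (hI : ∀ f : Bloch 1, IsIntegralHilbert μ α f (T f)) :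
    IsCompactOperator T := by
  have hα0 : 0 ≤ α := by linarith
  have : CompleteSpace (Bloch (α - 1)) := Bloch.completeSpace (by linarith)
  obtain ⟨s₀, hs₀, -, hT₀⟩ := hT 1 one_pos
  obtain ⟨K₀, hK₀, hT₁⟩ := hT₀.exists_one hs₀
  choose S hS hSf using exists_sampledOperator hα hμ hK₀ hT₁
  have hlim : Tendsto S atTop (𝓝 T) := by
    rw [Metric.tendsto_atTop]
    intro ε hε
    set A := 1 + α * 2 ^ (α - 1)
    have hA : 0 < A := by positivity
    -- First `s`, then `N` depending on `s`: the near and far errors are each at most `ε/4 · ‖f‖`,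
    -- since `A · 12 · ε/(48A) = ε/4`.
    obtain ⟨s, hs, hs1, hTs⟩ := hT (ε / (A * 48)) (by positivity)
    obtain ⟨N, hN⟩ := exists_nat_ge (μ.real Set.univ / s ^ 4 * (4 * A / ε))
    refine ⟨N, fun n hn => ?_⟩
    rw [dist_comm, dist_eq_norm]
    refine (ContinuousLinearMap.opNorm_le_bound _ (by positivity : 0 ≤ ε / 2) fun f => ?_).trans_lt
      (half_lt_self hε)
    have hc := cubicBound_sub_sampled (by positivity) hs hs1 hTs f n
    have hi1 := integrable_apply_toDisk hμ f
    have hm2 : AEStronglyMeasurable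
        (fun t => f (toDisk (cellPoint n (cellIndex n t)))) μ :=
      (((measurable_of_finite fun j => f (toDisk (cellPoint n j))).comp
        (measurable_cellIndex n))).aestronglyMeasurable
    have hi2 := integrable_of_le_logWeight hμ (M := ‖f‖) hm2 fun t =>
      (f.norm_apply_toDisk_le _).trans
        (mul_le_mul_of_nonneg_left (logWeight_mono (cellPoint_cellIndex_le n t)) (norm_nonneg f))
    have hd : ((T - S n) f).toFun = transform μ α
        (fun t => f (toDisk t) - f (toDisk (cellPoint n (cellIndex n t)))) := by
      have h1 : ((T - S n) f).toFun = (T f).toFun + (-1 : ℂ) • (S n f).toFun := by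
        rw [← Bloch.toFun_smul, ← Bloch.toFun_add, neg_one_smul, ← sub_eq_add_neg]
        rfl
      rw [h1, (hI f).eq_transform, hSf, ← transform_smul, ← transform_add hα0 hi1 (hi2.smul _)]
      congr 1
      funext t
      simp [sub_eq_add_neg]
    refine (hc.norm_le (by positivity) hα (hi1.sub hi2) hd).trans ?_
    have hn' : μ.real Set.univ / s ^ 4 * ((n : ℝ) + 1)⁻¹ ≤ ε / (4 * A) := by
      have h2 : (N : ℝ) ≤ n := by exact_mod_cast hn
      rw [← div_eq_mul_inv, div_le_iff₀ (by positivity)]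
      have h3 : μ.real Set.univ / s ^ 4 * (4 * A / ε) ≤ n + 1 := by linarith
      calc μ.real Set.univ / s ^ 4
          = ε / (4 * A) * (μ.real Set.univ / s ^ 4 * (4 * A / ε)) := by field_simp
        _ ≤ _ := by gcongr
    calc A * (‖f‖ * (12 * (ε / (A * 48)) + μ.real Set.univ / s ^ 4 * ((n : ℝ) + 1)⁻¹))
        ≤ A * (‖f‖ * (12 * (ε / (A * 48)) + ε / (4 * A))) := by gcongr
      _ = ε / 2 * ‖f‖ := by
        field_simp
        ring
  exact isCompactOperator_of_tendsto hlim (Eventually.of_forall hS)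

end

/-! ### Carleson boxes and tails -/

section

variable {μ : Measure UnitIco} {α : ℝ}

/-- Compare moduli; `ℓ ≤ 2π` keeps the radial parameter nonnegative, so it is the modulus. -/
theorem preimage_carlesonBox_subset (θ ℓ : ℝ) (hℓ : ℓ ≤ 2 * Real.pi) :
    toDisk ⁻¹' (Subtype.val ⁻¹' carlesonBox θ ℓ) ⊆ endSet (ℓ / (2 * Real.pi)) := by
  rintro t ⟨r, x, -, hr, -, h⟩
  have hr0 : 0 ≤ r := by
    have : ℓ / (2 * Real.pi) ≤ 1 := (div_le_one (by positivity)).mpr hℓ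
    linarith
  have h1 : ‖((t : ℝ) : ℂ)‖ = ‖(r : ℂ) * Complex.exp (x * Complex.I)‖ := congrArg norm h
  rw [norm_mul, Complex.norm_exp_ofReal_mul_I, mul_one, Complex.norm_real, Complex.norm_real,
    Real.norm_eq_abs, Real.norm_eq_abs, abs_of_nonneg t.2.1, abs_of_nonneg hr0] at h1
  simp only [endSet, Set.mem_ofPred_eq]
  linarith

theorem preimage_carlesonBox_eq {ℓ : ℝ} (hℓ0 : 0 ≤ ℓ) (hℓ : ℓ ≤ 2 * Real.pi) :
    toDisk ⁻¹' (Subtype.val ⁻¹' carlesonBox (-(ℓ / 2)) ℓ) = endSet (ℓ / (2 * Real.pi)) := by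
  refine (preimage_carlesonBox_subset _ _ hℓ).antisymm fun t ht => ?_
  simp only [endSet, Set.mem_ofPred_eq] at ht
  refine ⟨t, 0, ⟨by linarith, by linarith⟩, by linarith, t.2.2.le, ?_⟩
  simp [toDisk]

theorem measurableSet_carlesonBox (θ ℓ : ℝ) : MeasurableSet (carlesonBox θ ℓ) := by
  have h : carlesonBox θ ℓ = (fun p : ℝ × ℝ => (p.1 : ℂ) * Complex.exp (p.2 * Complex.I)) ''
      (Set.Icc (1 - ℓ / (2 * Real.pi)) 1 ×ˢ Set.Icc θ (θ + ℓ)) := by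
    ext z
    constructor
    · rintro ⟨r, t, ht, hr, hr1, rfl⟩
      exact ⟨(r, t), ⟨⟨hr, hr1⟩, ht⟩, rfl⟩
    · rintro ⟨⟨r, t⟩, ⟨⟨hr, hr1⟩, ht⟩, rfl⟩
      exact ⟨r, t, ht, hr, hr1, rfl⟩
  rw [h]
  exact ((isCompact_Icc.prod isCompact_Icc).image (by fun_prop)).isClosed.measurableSet

theorem diskMeasure_carlesonBox (θ ℓ : ℝ) :
    diskMeasure μ (Subtype.val ⁻¹' carlesonBox θ ℓ)
      = μ (toDisk ⁻¹' (Subtype.val ⁻¹' carlesonBox θ ℓ)) :=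
  Measure.map_apply measurable_toDisk
    (measurable_subtype_coe (measurableSet_carlesonBox θ ℓ))

/-- The condition on all boxes over arcs of a given length in terms of the tails of `μ`. -/
theorem forall_logBoxMass_div_le_iff {c ℓ : ℝ} (hc : 0 ≤ c) (hℓ0 : 0 < ℓ)
    (hℓ : ℓ ≤ 2 * Real.pi) :
    (∀ θ, logBoxMass 1 (diskMeasure μ) θ ℓ / ENNReal.ofReal (ℓ ^ (2 : ℝ)) ≤ ENNReal.ofReal c) ↔
      μ (endSet (ℓ / (2 * Real.pi))) * ENNReal.ofReal (-Real.log (ℓ / (2 * Real.pi)))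
        ≤ ENNReal.ofReal (4 * Real.pi ^ 2 * c * (ℓ / (2 * Real.pi)) ^ 2) := by
  have hlog : Real.log (2 * Real.pi / ℓ) ^ (1 : ℝ) = -Real.log (ℓ / (2 * Real.pi)) := by
    rw [Real.rpow_one, ← Real.log_inv, inv_div]
  have hsq : c * ℓ ^ (2 : ℝ) = 4 * Real.pi ^ 2 * c * (ℓ / (2 * Real.pi)) ^ 2 := by
    rw [Real.rpow_two]
    field_simp
    ring
  have hpos : 0 < ℓ ^ (2 : ℝ) := Real.rpow_pos_of_pos hℓ0 _
  simp only [logBoxMass, diskMeasure_carlesonBox, hlog]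
  simp only [ENNReal.div_le_iff (ENNReal.ofReal_pos.mpr hpos).ne' ENNReal.ofReal_ne_top,
    ← ENNReal.ofReal_mul hc, hsq]
  constructor
  · intro h
    have := h (-(ℓ / 2))
    rwa [preimage_carlesonBox_eq hℓ0.le hℓ] at this
  · intro h θ
    refine le_trans ?_ h
    gcongr
    exact preimage_carlesonBox_subset θ ℓ hℓ

/-- For `u ≤ 1/e` one has `1 ≤ -log u`, so `log(e/u)` costs at most twice `log(1/u)`. The
restriction is essential, as `log(1/u)` vanishes at `u = 1`. -/
theorem tailBound_of_forall_log {c s : ℝ} (hs : s ≤ Real.exp (-1))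
    (h : ∀ u, 0 < u → u ≤ s →
      μ (endSet u) * ENNReal.ofReal (-Real.log u) ≤ ENNReal.ofReal (c * u ^ 2)) :
    TailBound μ (2 * c) s := by
  intro u hu hus
  have hlog : Real.log u ≤ -1 := by
    have := Real.log_le_log hu (hus.trans hs)
    rwa [Real.log_exp] at this
  calc μ (endSet u) * ENNReal.ofReal (1 - Real.log u)
      ≤ μ (endSet u) * ENNReal.ofReal (2 * -Real.log u) := by
        gcongr
        linarith
    _ = ENNReal.ofReal 2 * (μ (endSet u) * ENNReal.ofReal (-Real.log u)) := by
        rw [ENNReal.ofReal_mul (by norm_num), mul_left_comm]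
    _ ≤ ENNReal.ofReal 2 * ENNReal.ofReal (c * u ^ 2) := mul_le_mul_right (h u hu hus) _
    _ = ENNReal.ofReal (2 * c * u ^ 2) := by
        rw [← ENNReal.ofReal_mul (by norm_num), mul_assoc]

theorem TailBound.log_le {K s u : ℝ} (h : TailBound μ K s) (hu : 0 < u) (hus : u ≤ s) :
    μ (endSet u) * ENNReal.ofReal (-Real.log u) ≤ ENNReal.ofReal (K * u ^ 2) := by
  refine le_trans ?_ (h u hu hus)
  gcongr
  linarith

theorem exp_neg_one_le_one : Real.exp (-1) ≤ 1 := Real.exp_le_one_iff.mpr (by norm_num)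

theorem isLogCarleson_iff [IsFiniteMeasure μ] :
    IsLogCarleson 1 2 (diskMeasure μ) ↔ ∃ s K : ℝ, 0 < s ∧ 0 ≤ K ∧ ∀ u, 0 < u → u ≤ s →
      μ (endSet u) * ENNReal.ofReal (-Real.log u) ≤ ENNReal.ofReal (K * u ^ 2) := by
  have hpi := Real.pi_pos
  constructor
  · rintro ⟨C, hC, h⟩
    refine ⟨1, 4 * Real.pi ^ 2 * C, one_pos, by positivity, fun u hu hu1 => ?_⟩
    have hl : 2 * Real.pi * u ≤ 2 * Real.pi := mul_le_of_le_one_right (by positivity) hu1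
    have h1 := (forall_logBoxMass_div_le_iff hC.le (by positivity) hl).mp
      fun θ => h θ _ (by positivity) hl
    rwa [mul_div_cancel_left₀ u (by positivity)] at h1
  · rintro ⟨s, K, hs, hK, h⟩
    obtain ⟨L, hL, hT⟩ := (tailBound_of_forall_log (min_le_right s (Real.exp (-1)))
      fun u hu hus => h u hu (hus.trans (min_le_left _ _))).exists_one
        (lt_min hs (Real.exp_pos _))
    -- `L` may be zero while the Carleson constant must be positive; `4π²` comes from `ℓ² = 4π² u²`.
    refine ⟨(L + 1) / (4 * Real.pi ^ 2), by positivity, fun θ ℓ hℓ0 hℓ => ?_⟩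
    refine (forall_logBoxMass_div_le_iff (by positivity) hℓ0 hℓ).mpr ?_ θ
    rw [mul_div_cancel₀ _ (by positivity)]
    exact (hT.mono (by linarith : L ≤ L + 1)).log_le (by positivity)
      ((div_le_one (by positivity)).mpr hℓ)

theorem exists_tailBound_of_isLogCarleson [IsFiniteMeasure μ]
    (h : IsLogCarleson 1 2 (diskMeasure μ)) : ∃ L, 0 ≤ L ∧ TailBound μ L 1 := by
  obtain ⟨s, K, hs, hK, h⟩ := isLogCarleson_iff.mp h
  exact (tailBound_of_forall_log (min_le_right s (Real.exp (-1)))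
    fun u hu hus => h u hu (hus.trans (min_le_left _ _))).exists_one (lt_min hs (Real.exp_pos _))

theorem isVanishingLogCarleson_iff :
    IsVanishingLogCarleson 1 2 (diskMeasure μ) ↔ ∀ ε : ℝ, 0 < ε → ∃ s : ℝ, 0 < s ∧
      ∀ u, 0 < u → u ≤ s →
        μ (endSet u) * ENNReal.ofReal (-Real.log u) ≤ ENNReal.ofReal (ε * u ^ 2) := by
  have hpi := Real.pi_pos
  constructor
  · intro h ε hε
    obtain ⟨δ, hδ, h⟩ := h (ε / (4 * Real.pi ^ 2)) (by positivity)
    refine ⟨min 1 (δ / (4 * Real.pi)), by positivity, fun u hu hus => ?_⟩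
    have hl : 2 * Real.pi * u ≤ 2 * Real.pi :=
      mul_le_of_le_one_right (by positivity) (hus.trans (min_le_left _ _))
    have hl' : 2 * Real.pi * u < δ := by
      have := hus.trans (min_le_right _ _)
      rw [le_div_iff₀ (by positivity)] at this
      linarith
    have h1 := (forall_logBoxMass_div_le_iff (by positivity) (by positivity) hl).mp
      fun θ => h θ _ (by positivity) hl hl'
    rwa [mul_div_cancel_left₀ u (by positivity), mul_div_cancel₀ _ (by positivity)] at h1
  · intro h ε hε
    obtain ⟨s, hs, h⟩ := h (4 * Real.pi ^ 2 * ε) (by positivity)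
    refine ⟨2 * Real.pi * s, by positivity, fun θ ℓ hℓ0 hℓ hℓs => ?_⟩
    refine (forall_logBoxMass_div_le_iff hε.le hℓ0 hℓ).mpr (h _ (by positivity) ?_) θ
    rw [div_le_iff₀ (by positivity)]
    linarith

theorem exists_tailBound_of_isVanishingLogCarleson
    (h : IsVanishingLogCarleson 1 2 (diskMeasure μ)) (ε : ℝ) (hε : 0 < ε) :
    ∃ s : ℝ, 0 < s ∧ s ≤ 1 ∧ TailBound μ ε s := by
  obtain ⟨s, hs, h⟩ := isVanishingLogCarleson_iff.mp h (ε / 2) (by positivity)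
  refine ⟨min s (Real.exp (-1)), lt_min hs (Real.exp_pos _),
    (min_le_right _ _).trans exp_neg_one_le_one, ?_⟩
  have h1 := tailBound_of_forall_log (min_le_right s (Real.exp (-1)))
    fun u hu hus => h u hu (hus.trans (min_le_left _ _))
  rwa [mul_div_cancel₀ _ two_ne_zero] at h1

end

/-! ### Necessity: logarithmic test functions -/

section

variable {μ : Measure UnitIco} {α : ℝ}

/-- Since `|1 - ρz| ≥ 1 - |z|`, the weighted derivative is at most `1 + |z|`, uniformly in `ρ` up to
and including `ρ = 1`. -/
theorem Bloch.exists_log {ρ : ℝ} (h0 : 0 ≤ ρ) (h1 : ρ ≤ 1) :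
    ∃ f : Bloch 1, ‖f‖ ≤ 2 ∧ ∀ z : Disk, f z = Complex.log (1 - (ρ : ℂ) * (z : ℂ)) := by
  set g : Disk → ℂ := fun z => Complex.log (1 - (ρ : ℂ) * (z : ℂ))
  have hn : ∀ z : Disk, ‖(ρ : ℂ) * (z : ℂ)‖ ≤ ‖(z : ℂ)‖ := fun z => by
    rw [norm_mul, Complex.norm_real, Real.norm_eq_abs, abs_of_nonneg h0]
    exact mul_le_of_le_one_left (norm_nonneg _) h1
  have hd : ∀ z : Disk, HasDerivAt (extend g) (-(ρ : ℂ) / (1 - (ρ : ℂ) * (z : ℂ))) z := by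
    intro z
    have hz : ‖(z : ℂ)‖ < 1 := mem_ball_zero_iff.mp z.2
    have hs : 1 - (ρ : ℂ) * (z : ℂ) ∈ Complex.slitPlane := by
      left
      have := (Complex.re_le_norm ((ρ : ℂ) * (z : ℂ))).trans (hn z)
      rw [Complex.sub_re, Complex.one_re]
      linarith
    have h := (((hasDerivAt_id (z : ℂ)).const_mul (ρ : ℂ)).const_sub 1).clog hs
    rw [mul_one] at h
    refine h.congr_of_eventuallyEq ?_
    filter_upwards [Metric.isOpen_ball.mem_nhds z.2] with w hw
    exact extend_apply g ⟨w, hw⟩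
  have hw : ∀ z : Disk, blochWeight 1 g z ≤ 2 := by
    intro z
    have hz : ‖(z : ℂ)‖ < 1 := mem_ball_zero_iff.mp z.2
    have hz0 : 0 < 1 - ‖(z : ℂ)‖ := sub_pos.mpr hz
    have hlow : 1 - ‖(z : ℂ)‖ ≤ ‖1 - (ρ : ℂ) * (z : ℂ)‖ := by
      have := norm_sub_norm_le (1 : ℂ) ((ρ : ℂ) * (z : ℂ))
      rw [norm_one] at this
      linarith [hn z]
    rw [blochWeight, diskDeriv, (hd z).deriv, Real.rpow_one, norm_div, norm_neg, Complex.norm_real,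
      Real.norm_eq_abs, abs_of_nonneg h0]
    calc (1 - ‖(z : ℂ)‖ ^ 2) * (ρ / ‖1 - (ρ : ℂ) * (z : ℂ)‖)
        ≤ (1 - ‖(z : ℂ)‖ ^ 2) * (1 / (1 - ‖(z : ℂ)‖)) := by
          have := z.one_sub_sq_pos
          gcongr
      _ = 1 + ‖(z : ℂ)‖ := by
          field_simp
          ring
      _ ≤ 2 := by linarith
  let f : Bloch 1 := ⟨g, fun z hz => (hd ⟨z, hz⟩).differentiableAt.differentiableWithinAt, 2, by
    rintro _ ⟨z, rfl⟩
    exact hw z⟩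
  refine ⟨f, ?_, fun z => rfl⟩
  have h := f.norm_le_of_blochWeight_le hw
  have hf0 : f Disk.zero = 0 := by
    change Complex.log (1 - (ρ : ℂ) * ((0 : ℂ))) = 0
    simp
  rwa [hf0, norm_zero, zero_add] at h

/-- The functions `log ((1 - ρ z) / (1 - z))` form a bounded family in the Bloch space. -/
theorem Bloch.exists_log_div {ρ : ℝ} (h0 : 0 ≤ ρ) (h1 : ρ ≤ 1) :
    ∃ f : Bloch 1, ‖f‖ ≤ 4 ∧ ∀ t : UnitIco,
      f (toDisk t) = ((Real.log (1 - ρ * t) - Real.log (1 - (t : ℝ)) : ℝ) : ℂ) := by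
  obtain ⟨f, hf, hfz⟩ := exists_log h0 h1
  obtain ⟨g, hg, hgz⟩ := exists_log zero_le_one le_rfl
  refine ⟨f - g, (_root_.norm_sub_le f g).trans (by linarith), fun t => ?_⟩
  have h : (f - g : Bloch 1).toFun (toDisk t) = f (toDisk t) - g (toDisk t) := rfl
  have ht : 0 ≤ 1 - ρ * t := by nlinarith [t.2.1, t.2.2]
  rw [h, hfz, hgz, Complex.ofReal_sub, Complex.ofReal_log ht, Complex.ofReal_log (one_sub_pos t).le]
  simp [toDisk]

/-- Testing at the point `1 - s` bounds the mass of `[1 - s, 1)`. -/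
theorem measure_endSet_mul_le [IsFiniteMeasure μ] (hα : 2 ≤ α) {h : UnitIco → ℝ}
    (hi : Integrable h μ) (h0 : ∀ t, 0 ≤ h t) {s L : ℝ} (hs : 0 < s) (hs2 : s ≤ 1 / 2)
    (hL : 0 ≤ L) (hhL : ∀ t ∈ endSet s, L ≤ h t) {g : Bloch (α - 1)}
    (hg : g.toFun = transform μ α fun t => (h t : ℂ)) :
    μ.real (endSet s) * L ≤ 2 ^ (α + 2) / α * ‖g‖ * s ^ 2 := by
  have hα0 : 0 < α := by linarith
  set x := 1 - s
  have hx0 : 0 ≤ x := by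
    simp only [x]
    linarith
  have hnx : ‖(x : ℂ)‖ = x := by rw [Complex.norm_real, Real.norm_eq_abs, abs_of_nonneg hx0]
  let z : Disk := ⟨(x : ℂ), by
    rw [mem_ball_zero_iff, hnx]
    simp only [x]
    linarith⟩
  set k : UnitIco → ℝ := fun t => α * t * (1 - t * x) ^ (-(α + 1))
  have hsx : ∀ t : UnitIco, s ≤ 1 - t * x := fun t => by
    simp only [x]
    nlinarith [t.2.1, t.2.2]
  have hk0 : ∀ t, 0 ≤ k t := fun t =>
    mul_nonneg (mul_nonneg hα0.le t.2.1) (Real.rpow_nonneg (hs.le.trans (hsx t)) _)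
  have hkb : ∀ t, k t ≤ α * s ^ (-(α + 1)) := fun t => by
    have h1 : α * t ≤ α := mul_le_of_le_one_right hα0.le t.2.2.le
    have h2 : (1 - t * x) ^ (-(α + 1)) ≤ s ^ (-(α + 1)) :=
      Real.rpow_le_rpow_of_nonpos hs (hsx t) (by linarith)
    have h3 : 0 ≤ (1 - t * x) ^ (-(α + 1)) := Real.rpow_nonneg (hs.le.trans (hsx t)) _
    simp only [k]
    gcongr
  have hki : Integrable (fun t => h t * k t) μ := by
    refine hi.mul_bdd (c := α * s ^ (-(α + 1))) ?_ (Eventually.of_forall fun t => ?_)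
    · exact (by fun_prop : Measurable k).aestronglyMeasurable
    · rw [Real.norm_eq_abs, abs_of_nonneg (hk0 t)]
      exact hkb t
  have hder : diskDeriv g z = ((∫ t, h t * k t ∂μ : ℝ) : ℂ) := by
    have hd := diskDeriv_transform (φ := fun t => (h t : ℂ)) hα0.le hi.ofReal z
    rw [hg, hd, ← integral_complex_ofReal]
    refine integral_congr_ae (Eventually.of_forall fun t => ?_)
    simp only [k, kernel, z]
    rw [Complex.ofReal_mul, Complex.ofReal_mul, Complex.ofReal_mul,
      Complex.ofReal_cpow (hs.le.trans (hsx t))]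
    push_cast
    rfl
  -- A lower bound for `k` on `endSet s`: there `t ≥ 1/2` because `s ≤ 1/2`, and `1 - tx ≤ 2s`.
  set c := α / 2 * (2 * s) ^ (-(α + 1))
  have hc0 : 0 ≤ c := by positivity
  have hint : μ.real (endSet s) * (L * c) ≤ ∫ t, h t * k t ∂μ := by
    calc μ.real (endSet s) * (L * c) = ∫ t in endSet s, L * c ∂μ := by
          rw [setIntegral_const, smul_eq_mul]
      _ ≤ ∫ t in endSet s, h t * k t ∂μ := by
          refine setIntegral_mono_on (integrable_const _) hki.integrableOn
            (measurableSet_endSet s) fun t ht => ?_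
          have hts : 1 - (t : ℝ) ≤ s := ht
          have hck : c ≤ k t := by
            have h1 : (2 * s) ^ (-(α + 1)) ≤ (1 - t * x) ^ (-(α + 1)) := by
              refine Real.rpow_le_rpow_of_nonpos (hs.trans_le (hsx t)) ?_ (by linarith)
              simp only [x]
              nlinarith [t.2.1, t.2.2]
            have h2 : α / 2 ≤ α * t := by nlinarith
            simp only [c, k]
            have : 0 ≤ α * (t : ℝ) := mul_nonneg hα0.le t.2.1
            gcongr
          exact mul_le_mul (hhL t ht) hck hc0 (h0 t)
      _ ≤ ∫ t, h t * k t ∂μ := setIntegral_le_integral hki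
          (Eventually.of_forall fun t => mul_nonneg (h0 t) (hk0 t))
  have hw := Bloch.blochWeight_le_norm g z
  rw [blochWeight, hder] at hw
  have hwt : s ^ (α - 1) ≤ (1 - ‖(z : ℂ)‖ ^ 2) ^ (α - 1) := by
    refine Real.rpow_le_rpow hs.le ?_ (by linarith)
    simp only [z]
    rw [hnx]
    simp only [x]
    nlinarith
  have hmain : s ^ (α - 1) * (μ.real (endSet s) * (L * c)) ≤ ‖g‖ := by
    refine le_trans ?_ hw
    refine mul_le_mul hwt (hint.trans ?_) (by positivity)
      (Real.rpow_nonneg z.one_sub_sq_pos.le _)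
    rw [Complex.norm_real]
    exact Real.le_norm_self _
  -- The weight `s^(α-1)` against the kernel `s^(-α-1)` leaves `s⁻²` for every `α`: the source of
  -- the Carleson exponent `2`.
  have hsc : s ^ (α - 1) * c = α / 2 ^ (α + 2) / s ^ 2 := by
    simp only [c]
    rw [Real.mul_rpow (by norm_num) hs.le]
    have h1 : s ^ (α - 1) * s ^ (-(α + 1)) = (s ^ 2)⁻¹ := by
      rw [← Real.rpow_add hs, ← Real.rpow_natCast, ← Real.rpow_neg hs.le]
      congr 1
      push_cast
      ring
    have h2 : (2 : ℝ) ^ (α + 2) = 2 * 2 ^ (α + 1) := by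
      rw [← Real.rpow_one_add' (by norm_num) (by linarith)]
      congr 1
      ring
    calc s ^ (α - 1) * (α / 2 * (2 ^ (-(α + 1)) * s ^ (-(α + 1))))
        = α / 2 * 2 ^ (-(α + 1)) * (s ^ (α - 1) * s ^ (-(α + 1))) := by ring
      _ = _ := by
        rw [h1, h2, Real.rpow_neg (by norm_num)]
        field_simp
  have h2pos : (0 : ℝ) < 2 ^ (α + 2) := by positivity
  calc μ.real (endSet s) * L
      = 2 ^ (α + 2) / α * (s ^ (α - 1) * (μ.real (endSet s) * (L * c))) * s ^ 2 := by
        have : s ^ (α - 1) * (μ.real (endSet s) * (L * c))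
            = s ^ (α - 1) * c * (μ.real (endSet s) * L) := by ring
        rw [this, hsc]
        field_simp
    _ ≤ _ := by gcongr

/-- The test function `log ((1 - ρ z) / (1 - z))` controls the tails of `μ`. -/
theorem measure_endSet_mul_log_le [IsFiniteMeasure μ] (hα : 2 ≤ α) (hμ : Integrable logWeight μ)
    {T : Bloch 1 →L[ℂ] Bloch (α - 1)} (hI : ∀ f : Bloch 1, IsIntegralHilbert μ α f (T f))
    {ρ : ℝ} (hρ0 : 0 ≤ ρ) (hρ1 : ρ < 1) {f : Bloch 1}
    (hf : ∀ t : UnitIco,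
      f (toDisk t) = ((Real.log (1 - ρ * t) - Real.log (1 - (t : ℝ)) : ℝ) : ℂ))
    {s : ℝ} (hs : 0 < s) (hs2 : s ≤ 1 / 2) (hsρ : s ≤ 1 - ρ) :
    μ.real (endSet s) * (Real.log (1 - ρ) - Real.log s) ≤ 2 ^ (α + 2) / α * ‖T f‖ * s ^ 2 := by
  have hρt : ∀ t : UnitIco, 1 - ρ ≤ 1 - ρ * t := fun t => by nlinarith [t.2.1, t.2.2]
  have hi := (integrable_apply_toDisk hμ f).re
  refine measure_endSet_mul_le hα
    (h := fun t => Real.log (1 - ρ * t) - Real.log (1 - (t : ℝ))) ?_ (fun t => ?_) hs hs2 ?_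
    (fun t ht => ?_) ?_
  · refine hi.congr (Eventually.of_forall fun t => ?_)
    simp only [hf]
    exact Complex.ofReal_re _
  · exact sub_nonneg.mpr (Real.log_le_log (one_sub_pos t) (by nlinarith [t.2.1]))
  · exact sub_nonneg.mpr (Real.log_le_log hs hsρ)
  · have h1 := Real.log_le_log (by linarith) (hρt t)
    have h2 := Real.log_le_log (one_sub_pos t) ht
    linarith
  · rw [(hI f).eq_transform]
    congr 1
    exact funext hf

theorem ofReal_measure_endSet_mul_le [IsFiniteMeasure μ] {u L C : ℝ}
    (h : μ.real (endSet u) * L ≤ C) :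
    μ (endSet u) * ENNReal.ofReal L ≤ ENNReal.ofReal C := by
  rw [← ofReal_measureReal, ← ENNReal.ofReal_mul measureReal_nonneg]
  exact ENNReal.ofReal_le_ofReal h

/-- The case `ρ = 0`: the single function `-log(1 - z)` tests all scales at once. -/
theorem isLogCarleson_of_integralHilbert [IsFiniteMeasure μ] (hα : 2 ≤ α)
    (hμ : Integrable logWeight μ) {T : Bloch 1 →L[ℂ] Bloch (α - 1)}
    (hI : ∀ f : Bloch 1, IsIntegralHilbert μ α f (T f)) :
    IsLogCarleson 1 2 (diskMeasure μ) := by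
  have hα0 : 0 < α := by linarith
  obtain ⟨f, -, hf⟩ := Bloch.exists_log_div le_rfl zero_le_one
  refine isLogCarleson_iff.mpr ⟨1 / 2, 2 ^ (α + 2) / α * ‖T f‖, by norm_num, by positivity,
    fun u hu hu2 => ofReal_measure_endSet_mul_le ?_⟩
  have h := measure_endSet_mul_log_le hα hμ hI le_rfl one_pos hf hu hu2 (by linarith)
  simpa using h

/-- As `ρ → 1` the images tend to zero pointwise by dominated convergence. Compactness gives a
norm-convergent subsequence, whose limit must be zero because point evaluations are continuous. -/
theorem exists_norm_integralHilbert_le (hα : 2 ≤ α) (hμ : Integrable logWeight μ)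
    {T : Bloch 1 →L[ℂ] Bloch (α - 1)} (hI : ∀ f : Bloch 1, IsIntegralHilbert μ α f (T f))
    (hT : IsCompactOperator T) {ε : ℝ} (hε : 0 < ε) :
    ∃ ρ : ℝ, 0 ≤ ρ ∧ ρ < 1 ∧ ∃ f : Bloch 1, ‖T f‖ ≤ ε ∧ ∀ t : UnitIco,
      f (toDisk t) = ((Real.log (1 - ρ * t) - Real.log (1 - (t : ℝ)) : ℝ) : ℂ) := by
  have hα0 : 0 ≤ α := by linarith
  set ρ : ℕ → ℝ := fun n => 1 - 1 / ((n : ℝ) + 1)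
  have hρ0 : ∀ n, 0 ≤ ρ n := fun n => by
    simp only [ρ]
    rw [sub_nonneg, div_le_one (by positivity)]
    linarith [(n.cast_nonneg : (0 : ℝ) ≤ n)]
  have hρ1 : ∀ n, ρ n < 1 := fun n => by
    simp only [ρ]
    have : 0 < 1 / ((n : ℝ) + 1) := by positivity
    linarith
  have hρlim : Tendsto ρ atTop (𝓝 1) := by
    simpa [ρ] using tendsto_one_div_add_atTop_nhds_zero_nat.const_sub (1 : ℝ)
  choose f hf hft using fun n => Bloch.exists_log_div (hρ0 n) (hρ1 n).le
  obtain ⟨K, hK, hKT⟩ := IsCompactOperator.image_closedBall_subset_compact (f := T.toLinearMap) hT 4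
  have hmem : ∀ n, T (f n) ∈ K := fun n =>
    hKT ⟨f n, mem_closedBall_zero_iff.mpr (hf n), rfl⟩
  obtain ⟨g, -, φ, hφ, hlim⟩ := hK.tendsto_subseq hmem
  have hpt : ∀ z : Disk, Tendsto (fun n => (T (f n)) z) atTop (𝓝 0) := by
    intro z
    have hz : 0 < 1 - ‖(z : ℂ)‖ := sub_pos.mpr (mem_ball_zero_iff.mp z.2)
    have h1 : ∀ n, (T (f n)) z = ∫ t, (f n) (toDisk t) * kernel α z t ∂μ := fun n =>
      congrFun (hI (f n)).eq_transform z
    simp only [h1]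
    suffices h0 : Tendsto (fun n => ∫ t, (f n) (toDisk t) * kernel α z t ∂μ) atTop
        (𝓝 (∫ _ : UnitIco, (0 : ℂ) ∂μ)) by rwa [integral_zero] at h0
    refine tendsto_integral_of_dominated_convergence
      (fun t => logWeight t * (1 - ‖(z : ℂ)‖) ^ (-α))
      (fun n => (integrable_mul_kernel hα0 (integrable_apply_toDisk hμ (f n)) z).1)
      (hμ.mul_const _) (fun n => Eventually.of_forall fun t => ?_)
      (Eventually.of_forall fun t => ?_)
    · rw [norm_mul]
      have hρt : 1 - (t : ℝ) ≤ 1 - ρ n * t := by nlinarith [t.2.1, hρ1 n]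
      -- Since `log(1 - ρt) ≤ 0`, a majorant independent of `n` is available.
      have h2 : ‖(f n) (toDisk t)‖ ≤ logWeight t := by
        rw [hft, Complex.norm_real, Real.norm_eq_abs, abs_of_nonneg
          (sub_nonneg.mpr (Real.log_le_log (one_sub_pos t) hρt)), logWeight_eq]
        have := Real.log_nonpos ((one_sub_pos t).le.trans hρt)
          (by nlinarith [mul_nonneg (hρ0 n) t.2.1])
        linarith
      exact mul_le_mul h2 (norm_kernel_le hα0 hz le_rfl t) (norm_nonneg _)
        (zero_le_one.trans (one_le_logWeight t))
    · suffices h2 : Tendsto (fun n => (f n) (toDisk t)) atTop (𝓝 0) by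
        simpa using h2.mul_const (kernel α z t)
      simp only [hft]
      refine (Complex.continuous_ofReal.tendsto 0).comp ?_
      have h3 : Tendsto (fun n => 1 - ρ n * (t : ℝ)) atTop (𝓝 (1 - 1 * (t : ℝ))) :=
        (hρlim.mul_const _).const_sub 1
      rw [one_mul] at h3
      simpa using (h3.log (one_sub_pos t).ne').sub_const (Real.log (1 - (t : ℝ)))
  have hg : g = 0 := by
    refine Bloch.toFun_injective (funext fun z => ?_)
    have h1 := ((Bloch.eval (by linarith : 0 ≤ α - 1) z).continuous.tendsto g).comp hlim
    exact tendsto_nhds_unique h1 ((hpt z).comp hφ.tendsto_atTop)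
  rw [hg] at hlim
  obtain ⟨n, hn⟩ := (hlim.norm.eventually (ge_mem_nhds (by simpa using hε))).exists
  exact ⟨ρ (φ n), hρ0 _, hρ1 _, f (φ n), hn, hft _⟩

theorem isVanishingLogCarleson_of_integralHilbert [IsFiniteMeasure μ] (hα : 2 ≤ α)
    (hμ : Integrable logWeight μ) {T : Bloch 1 →L[ℂ] Bloch (α - 1)}
    (hI : ∀ f : Bloch 1, IsIntegralHilbert μ α f (T f)) (hT : IsCompactOperator T) :
    IsVanishingLogCarleson 1 2 (diskMeasure μ) := by
  have hα0 : 0 < α := by linarith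
  refine isVanishingLogCarleson_iff.mpr fun ε hε => ?_
  set C := (2 : ℝ) ^ (α + 2) / α
  have hC : 0 < C := by positivity
  obtain ⟨ρ, hρ0, hρ1, f, hTf, hf⟩ := exists_norm_integralHilbert_le hα hμ hI hT
    (show 0 < ε / (2 * C) by positivity)
  have hρ : 0 < 1 - ρ := by linarith
  -- For `u ≤ (1 - ρ)²` one has `log(1/u) ≤ 2 log((1 - ρ)/u)`; this `2` is why the image was taken
  -- of norm at most `ε/(2C)`.
  refine ⟨min (1 / 2) ((1 - ρ) ^ 2), by positivity, fun u hu hus => ?_⟩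
  have hu2 := hus.trans (min_le_left _ _)
  have huρ := hus.trans (min_le_right _ _)
  have h1 := measure_endSet_mul_log_le hα hμ hI hρ0 hρ1 hf hu hu2 (by nlinarith)
  have hlog : Real.log u ≤ 2 * Real.log (1 - ρ) := by
    have := Real.log_le_log hu huρ
    rwa [Real.log_pow, Nat.cast_two] at this
  refine ofReal_measure_endSet_mul_le ?_
  calc μ.real (endSet u) * -Real.log u
      ≤ μ.real (endSet u) * (2 * (Real.log (1 - ρ) - Real.log u)) := by
        gcongr
        linarith
    _ = 2 * (μ.real (endSet u) * (Real.log (1 - ρ) - Real.log u)) := by ring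
    _ ≤ 2 * (C * ‖T f‖ * u ^ 2) := by gcongr
    _ ≤ 2 * (C * (ε / (2 * C)) * u ^ 2) := by gcongr
    _ = ε * u ^ 2 := by field_simp

theorem integrable_logWeight (hμ : ∫⁻ t : UnitIco,
    ENNReal.ofReal (Real.log (Real.exp 1 / (1 - (t : ℝ)))) ∂μ < ⊤) : Integrable logWeight μ :=
  (lintegral_ofReal_ne_top_iff_integrable measurable_logWeight.aestronglyMeasurable
    (Eventually.of_forall fun t => zero_le_one.trans (one_le_logWeight t))).mp hμ.ne

theorem isFiniteMeasure_of_integrable_logWeight (hμ : Integrable logWeight μ) :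
    IsFiniteMeasure μ := by
  refine (integrable_const_iff_isFiniteMeasure (one_ne_zero (α := ℝ))).mp ?_
  refine hμ.mono' aestronglyMeasurable_const (Eventually.of_forall fun t => ?_)
  simpa using one_le_logWeight t

end

end

end GenHilbert

theorem theorem2p6 (α : ℝ) (hα : 2 ≤ α) (μ : MeasureTheory.Measure GenHilbert.UnitIco)
    (hμ : ∫⁻ t : GenHilbert.UnitIco,
      ENNReal.ofReal (Real.log (Real.exp 1 / (1 - (t : ℝ)))) ∂μ < ⊤) :
    (GenHilbert.IntegralHilbertBounded μ α 1 (α - 1) ↔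
      GenHilbert.IsLogCarleson 1 2 (GenHilbert.diskMeasure μ)) ∧
    (GenHilbert.IntegralHilbertCompact μ α 1 (α - 1) ↔
      GenHilbert.IsVanishingLogCarleson 1 2 (GenHilbert.diskMeasure μ)) := by
  have hi := GenHilbert.integrable_logWeight hμ
  have := GenHilbert.isFiniteMeasure_of_integrable_logWeight hi
  refine ⟨⟨?_, fun h => ?_⟩, ⟨?_, fun h => ?_⟩⟩
  · rintro ⟨T, hT⟩
    exact GenHilbert.isLogCarleson_of_integralHilbert hα hi hT
  · obtain ⟨L, hL, hT⟩ := GenHilbert.exists_tailBound_of_isLogCarleson h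
    exact GenHilbert.exists_integralHilbert hα hi hL hT
  · rintro ⟨T, hT, hc⟩
    exact GenHilbert.isVanishingLogCarleson_of_integralHilbert hα hi hT hc
  · have htail := GenHilbert.exists_tailBound_of_isVanishingLogCarleson h
    obtain ⟨s, hs, -, hTs⟩ := htail 1 one_pos
    obtain ⟨L, hL, hT1⟩ := hTs.exists_one hs
    obtain ⟨T, hT⟩ := GenHilbert.exists_integralHilbert hα hi hL hT1
    exact ⟨T, hT, GenHilbert.isCompactOperator_integralHilbert hα hi htail hT⟩
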